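/- Let $\mathbb T^2=(\mathbb R/2\pi\mathbb Z)^2$ and $\langle n\rangle=(1+|n|^2)^{1/2}$ for $n\in\mathbb Z^2$. For $s\in\mathbb R$ let $H^s=H^s(\mathbb T^2)$ be the space of (complex-valued) distributions with norm $\|f\|_{H^s}=(\sum_{n}\langle n\rangle^{2s}|\widehat f(n)|^2)^{1/2}<\infty$, where $\widehat f(n)=(2\pi)^{-2}\int f(x)e^{-in\cdot x}\,dx$, and let $W^{s,\infty}$ be the space of distributions $f$ with $\langle\nabla\rangle^{s}f\in L^\infty(\mathbb T^2)$, normed by $\|\langle\nabla\rangle^s f\|_{L^\infty}$. Products of distributions are defined by $\widehat{ab}(n)=\sum_m\widehat a(m)\widehat b(n-m)$ whenever these sums converge absolutely. There is a constant $c>0$ such that the following holds for every integer $k\ge2$ and all real $\delta,\theta$ with $0<\theta\le c\,\delta$ and $\delta\le\frac1{2(k-1)}+\frac\theta2$. Consider, for $\varepsilon\in[0,1]$, the problem $$\varepsilon^2\partial_t^2v+\partial_tv+(1-\Delta)v+\sum_{\ell=0}^k\binom k\ell\,\Xi_\ell\,v^{k-\ell}=0,\qquad (v,\mathbf 1_{\varepsilon>0}\,\partial_tv)|_{t=0}=(\phi_0,\mathbf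 1_{\varepsilon>0}\,\phi_1),\qquad \Xi_0\equiv1, \tag{$*$}$$ with data $\phi_0\in H^{1-\delta+\theta}$, $\phi_1\in H^{-\delta+\theta}$ and sources $\Xi_1,\dots,\Xi_k\in C([0,1]\times[0,1];W^{-\theta,\infty})$ (functions of $(\varepsilon,t)$). A function $v\in C([0,1]\times[0,T];H^{1-\delta})$ of $(\varepsilon,t)$ is a solution on $[0,T]$ if, for each $\varepsilon\in[0,1]$ and each spatial frequency $n\in\mathbb Z^2$, the $n$-th Fourier coefficient of $(*)$ holds for all $t\in[0,T]$, with classical (at the endpoints one-sided) time derivatives, together with the initial conditions; for $\varepsilon=0$ this is the first-order equation with the single initial condition $v|_{t=0}=\phi_0$. Then: (0) All products in $(*)$ are well defined (the sums converge absolutely) for $v(\varepsilon,t)\in H^{1-\delta}$ and $\Xi_\ell(\varepsilon,t)\in W^{-\theta,\infty}$. For all $A,B\in\mathbb R$ there are $T\in(0,1]$ and $L$, depending only on $k,\delta,\theta,A,B$, such that: (1) for all data with $\|\phi_0\|_{H^{1-\delta+\theta}}+\|\phi_1\|_{H^{-\delta+\theta}}\le A$ and $\sum_{j=1}^k\|\Xi_j\|_{C([0,1]\times[0,1];W^{-\theta,\infty})}\le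 B$ there is exactly one solution $v$ of $(*)$ in the whole class $C([0,1]\times[0,T];H^{1-\delta})$; (2) the solution map is Lipschitz on this set of data: for two such data sets with solutions $v,v'$, $$\|v-v'\|_{C([0,1]\times[0,T];H^{1-\delta})}\le L\Big(\|\phi_0-\phi_0'\|_{H^{1-\delta+\theta}}+\|\phi_1-\phi_1'\|_{H^{-\delta+\theta}}+\sum_{j=1}^k\|\Xi_j-\Xi_j'\|_{C([0,1]\times[0,1];W^{-\theta,\infty})}\Big);$$ (3) if $\phi_0,\phi_1$ and all $\Xi_j(\varepsilon,t)$ are real-valued, then so is $v$. -/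

import Mathlib

open MeasureTheory
open scoped ENNReal

noncomputable section

namespace SNLW

/-! ### The torus, frequencies, periodic distributions

A point `x` of `𝕋² = (ℝ / 2πℤ)²` is written `x = 2π y` with `y : UnitAddTorus (Fin 2) = (ℝ / ℤ)²`.
Then Mathlib's character `UnitAddTorus.mFourier n` at `y` is `exp (2πi n·y) = exp (i n·x)`, so the
Laplacian in `x` is the Fourier multiplier `-|n|²`.  Distributions on `𝕋²` are represented by their
Fourier coefficients `f̂(n) = (2π)⁻² ∫ f(x) exp (-i n·x) dx`, `n ∈ ℤ²`. -/

/-- Frequencies `n ∈ ℤ²`. -/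
abbrev Freq : Type := Fin 2 → ℤ

/-- The Japanese bracket `⟨n⟩ = (1 + |n|²)^{1/2}`; `⟨n⟩²` is the symbol of `1 - Δ`. -/
def bracket (n : Freq) : ℝ := Real.sqrt (1 + (n 0 : ℝ) ^ 2 + (n 1 : ℝ) ^ 2)

/-- Normalised Lebesgue (Haar) measure on the torus; total mass `1`. -/
def torusMeasure : Measure (UnitAddTorus (Fin 2)) :=
  Measure.pi fun _ => AddCircle.haarAddCircle

lemma bracket_pos (n : Freq) : 0 < bracket n := Real.sqrt_pos.2 (by positivity)

instance : IsProbabilityMeasure torusMeasure := by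
  unfold torusMeasure; infer_instance

/-! ### The Sobolev spaces `H^s(𝕋²)` -/

/-- `{ f : ∑ₙ ⟨n⟩^{2s} |f̂(n)|² < ∞ }`. -/
def sobolevSubmodule (s : ℝ) : Submodule ℂ (Freq → ℂ) where
  carrier := {a | Memℓp (fun n => ((bracket n ^ s : ℝ) : ℂ) * a n) 2}
  add_mem' {a b} ha hb := by
    have h := Memℓp.add ha hb
    refine (congrArg (fun f : Freq → ℂ => Memℓp f 2) ?_).mp h
    funext n
    simp [mul_add]
  zero_mem' := by
    have h : Memℓp (0 : Freq → ℂ) 2 := zero_memℓp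
    refine (congrArg (fun f : Freq → ℂ => Memℓp f 2) ?_).mp h
    funext n
    simp
  smul_mem' c a ha := by
    have h := Memℓp.const_smul ha c
    refine (congrArg (fun f : Freq → ℂ => Memℓp f 2) ?_).mp h
    funext n
    simp [mul_left_comm]

/-- The Sobolev space `H^s(𝕋²)`, with norm `(∑ₙ ⟨n⟩^{2s} |f̂(n)|²)^{1/2}`. -/
def Hs (s : ℝ) : Type := ↥(sobolevSubmodule s)

namespace Hs

variable {s : ℝ}

instance : AddCommGroup (Hs s) := inferInstanceAs (AddCommGroup ↥(sobolevSubmodule s))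
instance : Module ℂ (Hs s) := inferInstanceAs (Module ℂ ↥(sobolevSubmodule s))

/-- Fourier coefficients of an element of `H^s`. -/
def coeff (f : Hs s) : Freq → ℂ := f.1

@[simp] lemma coeff_zero : (0 : Hs s).coeff = 0 := rfl
@[simp] lemma coeff_add (f g : Hs s) : (f + g).coeff = f.coeff + g.coeff := rfl
@[simp] lemma coeff_smul (c : ℂ) (f : Hs s) : (c • f).coeff = c • f.coeff := rfl

/-- `f ↦ (⟨n⟩^s f̂(n))ₙ`, from `H^s` to `ℓ²(ℤ²)`. -/
def toL2 (s : ℝ) : Hs s →ₗ[ℂ] lp (fun _ : Freq => ℂ) 2 where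
  toFun f := ⟨fun n => ((bracket n ^ s : ℝ) : ℂ) * f.coeff n, f.2⟩
  map_add' f g := by
    ext n
    exact mul_add _ _ _
  map_smul' c f := by
    ext n
    exact mul_left_comm _ _ _

lemma toL2_injective : Function.Injective (toL2 s) := by
  intro f g h
  refine Subtype.ext (funext fun n => ?_)
  have hn : ((bracket n ^ s : ℝ) : ℂ) * f.coeff n = ((bracket n ^ s : ℝ) : ℂ) * g.coeff n :=
    congrArg (fun u : lp (fun _ : Freq => ℂ) 2 => (u : Freq → ℂ) n) h
  exact mul_left_cancel₀
    (Complex.ofReal_ne_zero.2 (Real.rpow_pos_of_pos (bracket_pos n) s).ne') hn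

instance : NormedAddCommGroup (Hs s) :=
  NormedAddCommGroup.induced (Hs s) (lp (fun _ : Freq => ℂ) 2) (toL2 s) toL2_injective

instance : NormedSpace ℂ (Hs s) := NormedSpace.induced ℂ (Hs s) (lp (fun _ : Freq => ℂ) 2) (toL2 s)

end Hs

/-! ### The Sobolev spaces `W^{s,∞}(𝕋²)` -/

/-- The map `g ↦ ⟨∇⟩^{-s} g` on `L^∞(𝕋²)`, with values in distributions (Fourier coefficients). -/
def besselLinf (s : ℝ) : Lp ℂ ∞ torusMeasure →ₗ[ℂ] (Freq → ℂ) where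
  toFun g n := ((bracket n ^ (-s) : ℝ) : ℂ) * UnitAddTorus.mFourierCoeff g n
  map_add' f g := by
    have hint : ∀ (h : Lp ℂ ∞ torusMeasure) (n : Freq),
        Integrable (fun y => UnitAddTorus.mFourier (-n) y • h y) torusMeasure := fun h n =>
      ((Lp.memLp h).integrable le_top).bdd_mul (c := 1)
        (UnitAddTorus.mFourier (-n)).continuous.aestronglyMeasurable
        (Filter.Eventually.of_forall fun y =>
          ((UnitAddTorus.mFourier (-n)).norm_coe_le_norm y).trans UnitAddTorus.mFourier_norm.le)
    funext n
    have key : UnitAddTorus.mFourierCoeff (⇑(f + g)) n =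
        UnitAddTorus.mFourierCoeff f n + UnitAddTorus.mFourierCoeff g n := by
      refine Eq.trans (integral_congr_ae (μ := torusMeasure) ?_)
        (integral_add (hint f n) (hint g n))
      filter_upwards [Lp.coeFn_add f g] with y hy
      rw [hy, Pi.add_apply, smul_add]
    simp only [key, Pi.add_apply, mul_add]
  map_smul' c g := by
    funext n
    have key : UnitAddTorus.mFourierCoeff (⇑(c • g)) n = c * UnitAddTorus.mFourierCoeff g n := by
      refine Eq.trans (integral_congr_ae (μ := torusMeasure) ?_)
        (integral_const_mul c (fun y => UnitAddTorus.mFourier (-n) y • g y))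
      filter_upwards [Lp.coeFn_smul c g] with y hy
      simp only [hy, Pi.smul_apply, smul_eq_mul]
      ring
    simp only [key, Pi.smul_apply, smul_eq_mul, RingHom.id_apply]
    ring

lemma besselLinf_injective (s : ℝ) : Function.Injective (besselLinf s) := by
  rw [← LinearMap.ker_eq_bot, LinearMap.ker_eq_bot']
  intro g hg
  have hc : ∀ n, UnitAddTorus.mFourierCoeff g n = 0 := fun n =>
    (mul_eq_zero.1 (congrFun hg n)).resolve_left
      (Complex.ofReal_ne_zero.2 (Real.rpow_pos_of_pos (bracket_pos n) (-s)).ne')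
  have h2 : MemLp g 2 torusMeasure := (Lp.memLp g).mono_exponent le_top
  have hcoe : ∀ᵐ y ∂torusMeasure, h2.toLp g y = g y := h2.coeFn_toLp
  have hz : h2.toLp g = 0 := by
    refine (UnitAddTorus.mFourierBasis (d := Fin 2)).repr.injective
      (a₁ := h2.toLp g) (a₂ := 0) ?_
    refine lp.ext (funext fun n => (UnitAddTorus.mFourierBasis_repr _ n).trans ?_)
    refine Eq.trans (integral_congr_ae (μ := torusMeasure) ?_) ((hc n).trans ?_)
    · filter_upwards [hcoe] with y hy
      exact congrArg (fun z => UnitAddTorus.mFourier (-n) y • z) hy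
    · rw [map_zero]; rfl
  refine Lp.ext ?_
  rw [hz] at hcoe
  filter_upwards [hcoe, Lp.coeFn_zero ℂ 2 torusMeasure, Lp.coeFn_zero ℂ ∞ torusMeasure]
    with y h1 h3 h4
  rw [← h1, h3, h4]

/-- The Sobolev space `W^{s,∞}(𝕋²) = { f : ⟨∇⟩^s f ∈ L^∞ }`, with norm `‖⟨∇⟩^s f‖_{L^∞}`. -/
def WInf (s : ℝ) : Type := ↥(LinearMap.range (besselLinf s))

namespace WInf

variable {s : ℝ}

instance : AddCommGroup (WInf s) := inferInstanceAs (AddCommGroup ↥(LinearMap.range (besselLinf s)))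
instance : Module ℂ (WInf s) := inferInstanceAs (Module ℂ ↥(LinearMap.range (besselLinf s)))

/-- Fourier coefficients of an element of `W^{s,∞}`. -/
def coeff (f : WInf s) : Freq → ℂ := f.1

@[simp] lemma coeff_zero : (0 : WInf s).coeff = 0 := rfl
@[simp] lemma coeff_add (f g : WInf s) : (f + g).coeff = f.coeff + g.coeff := rfl
@[simp] lemma coeff_smul (c : ℂ) (f : WInf s) : (c • f).coeff = c • f.coeff := rfl

/-- The isomorphism `f ↦ ⟨∇⟩^s f` from `W^{s,∞}` to `L^∞`. -/
def toLinf (s : ℝ) : WInf s ≃ₗ[ℂ] Lp ℂ ∞ torusMeasure :=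
  (LinearEquiv.ofInjective (besselLinf s) (besselLinf_injective s)).symm

instance : NormedAddCommGroup (WInf s) :=
  NormedAddCommGroup.induced (WInf s) (Lp ℂ ∞ torusMeasure) (toLinf s) (toLinf s).injective

instance : NormedSpace ℂ (WInf s) :=
  NormedSpace.induced ℂ (WInf s) (Lp ℂ ∞ torusMeasure) (toLinf s)

end WInf

/-! ### Products -/

/-- The product of two distributions on the torus: `(ab)^(n) = ∑ₘ â(m) b̂(n - m)`
(meaningful when these sums converge absolutely, see `ProductDefined`). -/
def product (a b : Freq → ℂ) : Freq → ℂ := fun n => ∑' m, a m * b (n - m)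

/-- The sums that define the product of `a` and `b` converge absolutely. -/
def ProductDefined (a b : Freq → ℂ) : Prop := ∀ n, Summable fun m => ‖a m * b (n - m)‖

/-- Powers `a^j`, starting from `a^0 = 1` (the constant function). -/
def power (a : Freq → ℂ) : ℕ → Freq → ℂ
  | 0 => Pi.single 0 1
  | j + 1 => product (power a j) a

/-- `∑_{ℓ=0}^k binom(k,ℓ) Ξ_ℓ a^{k-ℓ}` with `Ξ_0 = 1`; the source `Ξ_{j+1}` is `ξ j`, `j < k`. -/
def nonlinearity {k : ℕ} (ξ : Fin k → Freq → ℂ) (a : Freq → ℂ) : Freq → ℂ := fun n =>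
  power a k n + ∑ j : Fin k, (k.choose (j + 1) : ℂ) * product (ξ j) (power a (k - (j + 1))) n

/-- A distribution on the torus is real-valued. -/
def IsRealValued (a : Freq → ℂ) : Prop := ∀ n, a (-n) = starRingEnd ℂ (a n)

/-! ### Solutions -/

/-- `v ∈ C([0,1] × [0,T]; H^s)` solves
`ε² ∂ₜ² v + ∂ₜ v + (1 - Δ) v + ∑_ℓ binom(k,ℓ) Ξ_ℓ v^{k-ℓ} = 0` on `[0,1] × [0,T]` (`T ≤ 1`) with
data `(v, 1_{ε>0} ∂ₜ v)|_{t=0} = (φ₀, 1_{ε>0} φ₁)`.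

For each `ε` the equation is required as an identity of spatial distributions at every time
`t ∈ [0,T]`, i.e. for every Fourier coefficient.  Here `u t` is `v(ε,t)` and `w t` is `∂ₜ v(ε,t)`,
with one-sided derivatives at the endpoints of `[0,T]`.  At `ε = 0` the equation is of first order
and the datum `φ₁` does not enter. -/
def IsSolution {k : ℕ} {s s₀ s₁ θ T : ℝ} (hT : 0 ≤ T) (φ₀ : Hs s₀) (φ₁ : Hs s₁)
    (Ξ : Fin k → C(Set.Icc (0 : ℝ) 1 × Set.Icc (0 : ℝ) 1, WInf (-θ)))
    (v : C(Set.Icc (0 : ℝ) 1 × Set.Icc (0 : ℝ) T, Hs s)) : Prop :=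
  ∀ ε : Set.Icc (0 : ℝ) 1, ∃ w : ℝ → Freq → ℂ,
    let u : ℝ → Freq → ℂ := fun t => (v (ε, Set.projIcc 0 T hT t)).coeff
    let N : ℝ → Freq → ℂ := fun t =>
      nonlinearity (fun j => (Ξ j (ε, Set.projIcc 0 1 zero_le_one t)).coeff) (u t)
    u 0 = φ₀.coeff ∧
    (∀ t ∈ Set.Icc 0 T, ∀ n, HasDerivWithinAt (fun r => u r n) (w t n) (Set.Icc 0 T) t) ∧
    ((ε : ℝ) = 0 → ∀ t ∈ Set.Icc 0 T, ∀ n,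
      w t n + (bracket n : ℂ) ^ 2 * u t n + N t n = 0) ∧
    (0 < (ε : ℝ) → w 0 = φ₁.coeff ∧ ∀ t ∈ Set.Icc 0 T, ∀ n, ∃ a : ℂ,
      HasDerivWithinAt (fun r => w r n) a (Set.Icc 0 T) t ∧
      ((ε : ℝ) : ℂ) ^ 2 * a + w t n + (bracket n : ℂ) ^ 2 * u t n + N t n = 0)

end SNLW

end

namespace SNLW

open Filter Topology

/-! ### The Japanese bracket -/

/-! The proof is a contraction argument resting on two facts: the linear equation gains one
derivative uniformly in `ε ∈ [0,1]`, and the nonlinearity loses at most one, being Lipschitz on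
bounded sets from `H^{1-δ}` to `H^{-δ}`.

Linear part. Each Fourier mode solves `ε² y'' + y' + μ y = f` with `μ = ⟨n⟩²`. Pairing with `2y'`
gives `d/dt (μ|y|² + ε²|y'|²) = 2⟨f - y', y'⟩ ≤ |f|²/2`, since the damping absorbs `y'`
(`ModeSol.energy`). Weighted summation over the modes bounds `v` in `H^{r+1}` by the data and the
`L²` norm in time of the force in `H^r`. Joint continuity in `(ε,t)`, including the singular limit
`ε → 0`, is proved for one mode by comparison with a smooth solution at the limiting parameter
(`continuous_mode`). It passes to the sum because the energy estimate makes the Fourier tails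
uniformly small (`exists_linSol`).

Nonlinear part. Powers of `v` are controlled by the Sobolev product estimate `Hs.exists_mul`; the
relation between `k`, `δ`, `θ` leaves `v^j` in `H^θ` for `j < k` and `v^k` in `H^{-δ}`. Products
with the sources need multiplication `W^{-θ,∞} × H^θ → H^{-θ}` (`WInf.exists_mul`). Writing `ξ =
⟨∇⟩^θ g` with `g` bounded, the matrix `ĝ(n-l)` is bounded on `ℓ²`, and it has to stay bounded after
entrywise multiplication by `⟨n⟩^{-θ} ⟨n-l⟩^θ ⟨l⟩^{-θ}`. This weight is a constant times `(1 -
G(n,l))^{θ/2}`, where `G` is the Gram kernel of vectors of length less than `1`. Powers of `G` are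
contractive Schur multipliers, and the binomial series of exponent `θ/2` has absolutely summable
coefficients (`OpBound.bracket_rpow`).

Uniqueness in the whole class follows from the energy estimate for a difference and Grönwall's
inequality; real-valuedness follows from uniqueness, because the complex conjugate of a solution
solves the same problem. -/

lemma bracket_sq (n : Freq) : bracket n ^ 2 = 1 + (n 0 : ℝ) ^ 2 + (n 1 : ℝ) ^ 2 :=
  Real.sq_sqrt (by positivity)

lemma one_le_bracket (n : Freq) : 1 ≤ bracket n := by
  rw [bracket, Real.one_le_sqrt]
  nlinarith [sq_nonneg (n 0 : ℝ), sq_nonneg (n 1 : ℝ)]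

lemma bracket_neg (n : Freq) : bracket (-n) = bracket n := by
  simp [bracket]

lemma bracket_add_le (m l : Freq) : bracket (m + l) ≤ bracket m + bracket l := by
  have hm := bracket_pos m
  have hl := bracket_pos l
  refine abs_le_of_sq_le_sq' ?_ (by positivity) |>.2
  have hc : (m 0 : ℝ) * l 0 + m 1 * l 1 ≤ bracket m * bracket l := by
    refine abs_le_of_sq_le_sq' ?_ (by positivity) |>.2
    rw [mul_pow, bracket_sq, bracket_sq]
    nlinarith [sq_nonneg ((m 0 : ℝ) * l 1 - m 1 * l 0), sq_nonneg (m 0 : ℝ), sq_nonneg (m 1 : ℝ),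
      sq_nonneg (l 0 : ℝ), sq_nonneg (l 1 : ℝ)]
  have e := bracket_sq (m + l)
  simp only [Pi.add_apply, Int.cast_add] at e
  rw [e]
  nlinarith [bracket_sq m, bracket_sq l]

lemma bracket_rpow_pos (n : Freq) (s : ℝ) : 0 < bracket n ^ s :=
  Real.rpow_pos_of_pos (bracket_pos n) s

lemma bracket_rpow_mono (n : Freq) {s s' : ℝ} (h : s ≤ s') : bracket n ^ s ≤ bracket n ^ s' :=
  Real.rpow_le_rpow_of_exponent_le (one_le_bracket n) h

lemma norm_le_bracket (n : Freq) : ‖n‖ ≤ bracket n := by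
  refine (pi_norm_le_iff_of_nonneg (bracket_pos n).le).2 fun i => ?_
  refine abs_le_of_sq_le_sq ?_ (bracket_pos n).le
  rw [bracket_sq]
  fin_cases i <;> simp only [Fin.zero_eta, Fin.mk_one] <;>
    nlinarith [sq_nonneg (n 0 : ℝ), sq_nonneg (n 1 : ℝ)]

/-- In two dimensions `⟨n⟩^{-2γ}` is summable once `2γ > 2`. The comparison with `‖n‖^{-2γ}`
excludes the origin, hence the cofinite filter. -/
lemma summable_bracket_rpow {γ : ℝ} (hγ : 1 < γ) :
    Summable fun n : Freq => (bracket n ^ (-γ)) ^ 2 := by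
  have h := EisensteinSeries.summable_one_div_norm_rpow (k := 2 * γ) (by linarith)
  refine Summable.of_norm_bounded_eventually h ?_
  filter_upwards [(Set.finite_singleton (0 : Freq)).compl_mem_cofinite] with n hn
  have hn' : 0 < ‖n‖ := norm_pos_iff.2 hn
  rw [Real.norm_of_nonneg (by positivity), ← Real.rpow_natCast, ← Real.rpow_mul (bracket_pos n).le]
  refine (Real.rpow_le_rpow_of_nonpos hn' (norm_le_bracket n) ?_).trans_eq ?_
  · push_cast; linarith
  · congr 1; push_cast; ring

/-! ### Norms in `H^s` through finite sums -/

/-- The partial sum over `S` of the squared `H^s` norm of the distribution with coefficients `a`. -/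
noncomputable def partialSq (s : ℝ) (a : Freq → ℂ) (S : Finset Freq) : ℝ :=
  ∑ n ∈ S, (bracket n ^ s * ‖a n‖) ^ 2

lemma partialSq_nonneg (s : ℝ) (a : Freq → ℂ) (S : Finset Freq) : 0 ≤ partialSq s a S :=
  Finset.sum_nonneg fun _ _ => sq_nonneg _

lemma partialSq_anti {s s' : ℝ} (h : s ≤ s') (a : Freq → ℂ) (S : Finset Freq) :
    partialSq s a S ≤ partialSq s' a S := by
  refine Finset.sum_le_sum fun n _ => ?_
  have := bracket_rpow_mono n h
  have := (bracket_rpow_pos n s).le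
  gcongr

namespace Hs

variable {s : ℝ}

@[simp] lemma coeff_sub (f g : Hs s) : (f - g).coeff = f.coeff - g.coeff := rfl
@[simp] lemma coeff_neg (f : Hs s) : (-f).coeff = -f.coeff := rfl

@[ext] lemma ext {f g : Hs s} (h : f.coeff = g.coeff) : f = g := Subtype.ext h

lemma norm_eq (f : Hs s) : ‖f‖ = ‖toL2 s f‖ := rfl

lemma toL2_apply (f : Hs s) (n : Freq) :
    (toL2 s f : Freq → ℂ) n = ((bracket n ^ s : ℝ) : ℂ) * f.coeff n := rfl

lemma norm_toL2_apply (f : Hs s) (n : Freq) :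
    ‖(toL2 s f : Freq → ℂ) n‖ = bracket n ^ s * ‖f.coeff n‖ := by
  rw [toL2_apply, norm_mul, Complex.norm_of_nonneg (bracket_rpow_pos n s).le]

lemma partialSq_le (f : Hs s) (S : Finset Freq) : partialSq s f.coeff S ≤ ‖f‖ ^ 2 := by
  have h := lp.sum_rpow_le_norm_rpow (p := 2) (by simp) (toL2 s f) S
  simp only [ENNReal.toReal_ofNat, Real.rpow_two, norm_toL2_apply] at h
  exact h

lemma norm_le_of_partialSq_le {f : Hs s} {C : ℝ} (hC : 0 ≤ C)
    (h : ∀ S, partialSq s f.coeff S ≤ C ^ 2) : ‖f‖ ≤ C := by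
  rw [norm_eq]
  refine lp.norm_le_of_forall_sum_le (p := 2) (by simp) hC fun S => ?_
  simp only [ENNReal.toReal_ofNat, Real.rpow_two, norm_toL2_apply]
  exact h S

lemma norm_sq_le_of_partialSq_le {f : Hs s} {C : ℝ}
    (h : ∀ S, partialSq s f.coeff S ≤ C) : ‖f‖ ^ 2 ≤ C := by
  have hC : 0 ≤ C := (partialSq_nonneg _ _ _).trans (h ∅)
  have := norm_le_of_partialSq_le (Real.sqrt_nonneg C) (f := f) fun S => by
    rw [Real.sq_sqrt hC]; exact h S
  calc ‖f‖ ^ 2 ≤ Real.sqrt C ^ 2 := by gcongr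
    _ = C := Real.sq_sqrt hC

/-- Products, linear solutions and conjugates are all built as coefficient families first; bounds on
finite sums then place them in `H^s`. -/
lemma exists_of_partialSq_le {a : Freq → ℂ} {C : ℝ} (h : ∀ S, partialSq s a S ≤ C) :
    ∃ f : Hs s, f.coeff = a := by
  refine ⟨⟨a, ?_⟩, rfl⟩
  refine memℓp_gen' (p := 2) (C := C) fun S => ?_
  refine le_trans (le_of_eq ?_) (h S)
  refine Finset.sum_congr rfl fun n _ => ?_
  rw [norm_mul, Complex.norm_of_nonneg (bracket_rpow_pos n s).le]
  simp

lemma norm_coeff_le (f : Hs s) (n : Freq) : bracket n ^ s * ‖f.coeff n‖ ≤ ‖f‖ := by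
  rw [← norm_toL2_apply]
  exact lp.norm_apply_le_norm (by simp) _ _

lemma toL2_surjective : Function.Surjective (toL2 s) := by
  intro u
  have hne : ∀ n : Freq, ((bracket n ^ s : ℝ) : ℂ) ≠ 0 := fun n =>
    Complex.ofReal_ne_zero.2 (bracket_rpow_pos n s).ne'
  have e : ∀ n, ((bracket n ^ s : ℝ) : ℂ) * (((bracket n ^ s : ℝ) : ℂ)⁻¹ * (u : Freq → ℂ) n) =
      (u : Freq → ℂ) n := fun n => mul_inv_cancel_left₀ (hne n) _
  refine ⟨⟨fun n => ((bracket n ^ s : ℝ) : ℂ)⁻¹ * (u : Freq → ℂ) n, ?_⟩, ?_⟩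
  · change Memℓp _ 2
    simp only [e]
    exact lp.memℓp u
  · ext n
    exact e n

/-- `H^s` is isometric to `ℓ²`. -/
noncomputable def toL2Isometry (s : ℝ) : Hs s ≃ₗᵢ[ℂ] lp (fun _ : Freq => ℂ) 2 where
  toLinearEquiv := LinearEquiv.ofBijective (toL2 s) ⟨toL2_injective, toL2_surjective⟩
  norm_map' _ := rfl

instance : CompleteSpace (Hs s) :=
  (toL2Isometry s).toIsometryEquiv.completeSpace

/-- The Fourier coefficient of order `n`, as a continuous linear functional on `H^s`. -/
noncomputable def coeffCLM (s : ℝ) (n : Freq) : Hs s →L[ℂ] ℂ :=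
  LinearMap.mkContinuous
    { toFun := fun f => f.coeff n
      map_add' := fun _ _ => rfl
      map_smul' := fun _ _ => rfl } ((bracket n ^ s)⁻¹) fun f => by
    rw [inv_mul_eq_div, le_div_iff₀' (bracket_rpow_pos n s)]
    exact f.norm_coeff_le n

/-- The inclusion `H^{s'} ⊆ H^s` for `s ≤ s'`. -/
lemma exists_inclusion {s s' : ℝ} (h : s ≤ s') :
    ∃ I : Hs s' →L[ℂ] Hs s, ∀ f, (I f).coeff = f.coeff := by
  have hb : ∀ (f : Hs s') S, partialSq s f.coeff S ≤ ‖f‖ ^ 2 := fun f S =>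
    (partialSq_anti h _ _).trans (f.partialSq_le S)
  choose I hI using fun f : Hs s' => exists_of_partialSq_le (hb f)
  refine ⟨LinearMap.mkContinuous ⟨⟨I, fun f g => ?_⟩, fun c f => ?_⟩ 1 fun f => ?_, hI⟩
  · ext1; simp [hI]
  · ext1; simp [hI]
  · rw [one_mul]
    exact norm_le_of_partialSq_le (norm_nonneg _) fun S => by
      simpa [hI] using hb f S

lemma exists_single (s : ℝ) (n : Freq) : ∃ e : Hs s, e.coeff = Pi.single n 1 := by
  refine exists_of_partialSq_le (C := (bracket n ^ s) ^ 2) fun S => ?_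
  rw [partialSq, ← Finset.sum_filter_add_sum_filter_not S (· = n)]
  rw [Finset.sum_eq_zero (s := S.filter (¬ · = n)), add_zero]
  · rw [Finset.filter_eq']
    split_ifs
    · simp
    · simp; positivity
  · intro m hm
    rw [Pi.single_eq_of_ne (Finset.mem_filter.1 hm).2]
    simp

end Hs

/-! ### Convolution products -/

lemma ProductDefined.summable {a b : Freq → ℂ} (h : ProductDefined a b) (n : Freq) :
    Summable fun m => a m * b (n - m) := (h n).of_norm

lemma product_comm (a b : Freq → ℂ) : product a b = product b a := by
  funext n
  rw [product, product, ← (Equiv.subLeft n).tsum_eq]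
  simp [mul_comm]

lemma ProductDefined.symm {a b : Freq → ℂ} (h : ProductDefined a b) : ProductDefined b a := by
  intro n
  rw [← (Equiv.subLeft n).summable_iff]
  simpa [Function.comp_def, mul_comm] using h n

/-- The inner sums converge, so a bound uniform in the finite set `S` survives the limit. Product
estimates therefore only have to be proved for finite sections. -/
lemma partialSq_product_le {a b : Freq → ℂ} {s C : ℝ} (hd : ProductDefined a b)
    (h : ∀ N S : Finset Freq,
      ∑ n ∈ N, (bracket n ^ s * ‖∑ m ∈ S, a m * b (n - m)‖) ^ 2 ≤ C) (N : Finset Freq) :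
    partialSq s (product a b) N ≤ C := by
  refine le_of_tendsto' (x := (atTop : Filter (Finset Freq))) ?_ (fun S => h N S)
  refine tendsto_finsetSum _ fun n _ => ?_
  exact ((((hd.summable n).hasSum).norm).const_mul _).pow 2

lemma sum_comp_sub_le {g : Freq → ℝ} {D : ℝ} (h : ∀ S : Finset Freq, ∑ m ∈ S, g m ≤ D)
    (n : Freq) (S : Finset Freq) : ∑ m ∈ S, g (n - m) ≤ D := by
  refine le_trans (le_of_eq ?_) (h (S.map (Equiv.subLeft n).toEmbedding))
  rw [Finset.sum_map]
  rfl

lemma sum_comp_sub_right_le {g : Freq → ℝ} {D : ℝ} (h : ∀ S : Finset Freq, ∑ m ∈ S, g m ≤ D)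
    (m : Freq) (S : Finset Freq) : ∑ n ∈ S, g (n - m) ≤ D := by
  refine le_trans (le_of_eq ?_) (h (S.map (Equiv.subRight m).toEmbedding))
  rw [Finset.sum_map]
  rfl

/-- A bounded product of distributions, as a continuous bilinear map. -/
lemma exists_bilinear_product {E F : Type*} [NormedAddCommGroup E] [NormedSpace ℂ E]
    [NormedAddCommGroup F] [NormedSpace ℂ F] (cE : E →ₗ[ℂ] (Freq → ℂ)) (cF : F →ₗ[ℂ] (Freq → ℂ))
    (hd : ∀ x y, ProductDefined (cE x) (cF y)) {s C : ℝ} (hC : 0 ≤ C)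
    (h : ∀ x y N, partialSq s (product (cE x) (cF y)) N ≤ (C * ‖x‖ * ‖y‖) ^ 2) :
    ∃ B : E →L[ℂ] F →L[ℂ] Hs s, ∀ x y, (B x y).coeff = product (cE x) (cF y) := by
  choose B hB using fun x y => Hs.exists_of_partialSq_le (h x y)
  refine ⟨LinearMap.mkContinuous₂ (LinearMap.mk₂ ℂ B ?_ ?_ ?_ ?_) C ?_, hB⟩
  · intro x x' y
    ext n
    simp only [hB, map_add, Hs.coeff_add, Pi.add_apply, product, add_mul]
    exact ((hd x y).summable n).tsum_add ((hd x' y).summable n)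
  · intro c x y
    ext n
    simp only [hB, map_smul, Hs.coeff_smul, Pi.smul_apply, product, smul_eq_mul, mul_assoc]
    exact tsum_mul_left
  · intro x y y'
    ext n
    simp only [hB, map_add, Hs.coeff_add, Pi.add_apply, product, mul_add]
    exact ((hd x y).summable n).tsum_add ((hd x y').summable n)
  · intro c x y
    ext n
    simp only [hB, map_smul, Hs.coeff_smul, Pi.smul_apply, product, smul_eq_mul,
      mul_left_comm _ c]
    exact tsum_mul_left
  · intro x y
    refine Hs.norm_le_of_partialSq_le (by positivity) fun S => ?_
    simpa only [LinearMap.mk₂_apply, hB] using h x y S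

/-- `coeff` as a linear map on `H^s`. -/
noncomputable def Hs.coeffLM (s : ℝ) : Hs s →ₗ[ℂ] (Freq → ℂ) where
  toFun := Hs.coeff
  map_add' _ _ := rfl
  map_smul' _ _ := rfl

/-- `coeff` as a linear map on `W^{s,∞}`. -/
noncomputable def WInf.coeffLM (s : ℝ) : WInf s →ₗ[ℂ] (Freq → ℂ) where
  toFun := WInf.coeff
  map_add' _ _ := rfl
  map_smul' _ _ := rfl

/-! ### Products of Sobolev distributions -/

lemma Hs.summable_norm_coeff_sq {s : ℝ} (hs : 0 ≤ s) (f : Hs s) :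
    Summable fun n => ‖f.coeff n‖ ^ 2 := by
  refine summable_of_sum_le (c := ‖f‖ ^ 2) (fun _ => sq_nonneg _) fun S => ?_
  refine le_trans (le_trans (le_of_eq ?_) (partialSq_anti hs _ _)) (f.partialSq_le S)
  simp [partialSq]

lemma productDefined_of_summable_sq {a b : Freq → ℂ} (ha : Summable fun n => ‖a n‖ ^ 2)
    (hb : Summable fun n => ‖b n‖ ^ 2) : ProductDefined a b := by
  intro n
  have hb' : Summable fun m => ‖b (n - m)‖ ^ 2 := by
    simpa [Function.comp_def] using ((Equiv.subLeft n).summable_iff).2 hb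
  refine Summable.of_nonneg_of_le (fun _ => norm_nonneg _) (fun m => ?_) (ha.add hb')
  rw [norm_mul]
  nlinarith [sq_nonneg (‖a m‖ - ‖b (n - m)‖), sq_nonneg ‖a m‖, sq_nonneg ‖b (n - m)‖]

/-- For `c ≤ 0` all three exponents are nonpositive, so each base may be replaced by the smallest
one. For `c > 0`, `x` is at most twice the larger of `y`, `z`; moving `x^c` onto that factor leaves
it a nonpositive exponent, and it can then be lowered to the smaller base. -/
lemma rpow_kernel_le {x y z a b c : ℝ} (hx : 1 ≤ x) (hy : 1 ≤ y) (hz : 1 ≤ z) (hxyz : x ≤ y + z)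
    (ha : 0 ≤ a) (hb : 0 ≤ b) (hca : c ≤ a) (hcb : c ≤ b) :
    x ^ c * y ^ (-a) * z ^ (-b) ≤
      2 ^ |c| * (x ^ (-(a + b - c)) + y ^ (-(a + b - c)) + z ^ (-(a + b - c))) := by
  have h2 : (1 : ℝ) ≤ 2 ^ |c| := Real.one_le_rpow one_le_two (abs_nonneg c)
  have px : 0 < x := by linarith
  have py : 0 < y := by linarith
  have pz : 0 < z := by linarith
  set Γ := a + b - c with hΓ
  have qx := (Real.rpow_pos_of_pos px (-Γ)).le
  have qy := (Real.rpow_pos_of_pos py (-Γ)).le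
  have qz := (Real.rpow_pos_of_pos pz (-Γ)).le
  rcases le_or_gt c 0 with hc | hc
  · have main : ∀ w : ℝ, 0 < w → w ≤ x → w ≤ y → w ≤ z →
        x ^ c * y ^ (-a) * z ^ (-b) ≤ w ^ (-Γ) := by
      intro w hw h1 h2 h3
      have e : w ^ (-Γ) = w ^ c * w ^ (-a) * w ^ (-b) := by
        rw [← Real.rpow_add hw, ← Real.rpow_add hw]; congr 1; rw [hΓ]; ring
      rw [e]
      gcongr ?_ * ?_ * ?_
      · exact Real.rpow_le_rpow_of_nonpos hw h1 hc
      · exact Real.rpow_le_rpow_of_nonpos hw h2 (by linarith)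
      · exact Real.rpow_le_rpow_of_nonpos hw h3 (by linarith)
    have hs : x ^ c * y ^ (-a) * z ^ (-b) ≤ x ^ (-Γ) + y ^ (-Γ) + z ^ (-Γ) := by
      rcases le_total x y with h | h <;> rcases le_total y z with h' | h' <;>
        rcases le_total x z with h'' | h''
      · linarith [main x px le_rfl h h'']
      · linarith [main x px le_rfl h (h.trans h')]
      · linarith [main x px le_rfl h h'']
      · linarith [main z pz h'' h' le_rfl]
      · linarith [main y py h le_rfl h']
      · linarith [main y py h le_rfl h']
      · linarith [main z pz (h'.trans h) h' le_rfl]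
      · linarith [main z pz h'' h' le_rfl]
    nlinarith
  · have main : ∀ u v p q : ℝ, 0 < u → u ≤ v → x ≤ u + v → 0 ≤ p → c ≤ q → p + q = a + b →
        x ^ c * (u ^ (-p) * v ^ (-q)) ≤ 2 ^ |c| * u ^ (-Γ) := by
      intro u v p q hu huv hxuv hp hq hpq
      have hv : 0 < v := by linarith
      calc x ^ c * (u ^ (-p) * v ^ (-q)) ≤ (2 * v) ^ c * (u ^ (-p) * v ^ (-q)) := by
            gcongr
            linarith
        _ = 2 ^ |c| * u ^ (-p) * v ^ (c - q) := by
            rw [Real.mul_rpow zero_le_two hv.le, abs_of_pos hc, sub_eq_add_neg, Real.rpow_add hv]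
            ring
        _ ≤ 2 ^ |c| * u ^ (-p) * u ^ (c - q) := by
            gcongr ?_ * ?_
            exact Real.rpow_le_rpow_of_nonpos hu huv (by linarith)
        _ = 2 ^ |c| * u ^ (-Γ) := by
            rw [mul_assoc, ← Real.rpow_add hu]
            congr 2
            linarith
    rcases le_total y z with h | h
    · have := main y z a b py h hxyz ha hcb rfl
      rw [mul_assoc]
      nlinarith
    · have := main z y b a pz h (by linarith) hb hca (by ring)
      rw [mul_assoc, mul_comm (y ^ (-a))]
      nlinarith

/-- A weighted convolution estimate on finite sets. -/
lemma sum_sq_convolution_le {A B g : Freq → ℝ} {a b z : ℝ}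
    (hA : ∀ S : Finset Freq, ∑ m ∈ S, A m ^ 2 ≤ a) (hB : ∀ S : Finset Freq, ∑ m ∈ S, B m ^ 2 ≤ b)
    (hg : ∀ S : Finset Freq, ∑ m ∈ S, g m ^ 2 ≤ z) (N S : Finset Freq) :
    ∑ n ∈ N, (∑ m ∈ S, (g n + g m + g (n - m)) * (A m * B (n - m))) ^ 2 ≤ 9 * (z * (a * b)) := by
  have ha : 0 ≤ a := by simpa using hA ∅
  have hb : 0 ≤ b := by simpa using hB ∅
  have hz : 0 ≤ z := by simpa using hg ∅
  have hAB : ∀ n, ∑ m ∈ S, (A m * B (n - m)) ^ 2 = ∑ m ∈ S, A m ^ 2 * B (n - m) ^ 2 := fun n =>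
    Finset.sum_congr rfl fun m _ => mul_pow _ _ _
  -- Cauchy–Schwarz is used in two ways. The weight `g n` leaves the inner sum, which is bounded
  -- uniformly in `n`, and is summed over `n` at the end. The weights `g m` and `g (n - m)` are
  -- paired with `A m * B (n - m)` inside the sum over `m`, and the remaining double sum factorises.
  have h0 : ∀ n, (∑ m ∈ S, A m * B (n - m)) ^ 2 ≤ a * b := fun n =>
    (Finset.sum_mul_sq_le_sq_mul_sq S A fun m => B (n - m)).trans <|
      mul_le_mul (hA S) (sum_comp_sub_le (g := fun m => B m ^ 2) hB n S)
        (Finset.sum_nonneg fun _ _ => sq_nonneg _) ha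
  have h1 : ∀ n, (∑ m ∈ S, g m * (A m * B (n - m))) ^ 2 ≤
      z * ∑ m ∈ S, A m ^ 2 * B (n - m) ^ 2 := fun n => by
    rw [← hAB]
    refine (Finset.sum_mul_sq_le_sq_mul_sq S g _).trans ?_
    have : 0 ≤ ∑ m ∈ S, (A m * B (n - m)) ^ 2 := Finset.sum_nonneg fun _ _ => sq_nonneg _
    gcongr
    exact hg S
  have h2 : ∀ n, (∑ m ∈ S, g (n - m) * (A m * B (n - m))) ^ 2 ≤
      z * ∑ m ∈ S, A m ^ 2 * B (n - m) ^ 2 := fun n => by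
    rw [← hAB]
    refine (Finset.sum_mul_sq_le_sq_mul_sq S (fun m => g (n - m)) _).trans ?_
    have : 0 ≤ ∑ m ∈ S, (A m * B (n - m)) ^ 2 := Finset.sum_nonneg fun _ _ => sq_nonneg _
    gcongr
    exact sum_comp_sub_le (g := fun m => g m ^ 2) hg n S
  have hpt : ∀ n, (∑ m ∈ S, (g n + g m + g (n - m)) * (A m * B (n - m))) ^ 2 ≤
      3 * (g n ^ 2 * (a * b)) + 6 * (z * ∑ m ∈ S, A m ^ 2 * B (n - m) ^ 2) := by
    intro n
    simp only [add_mul, Finset.sum_add_distrib]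
    rw [← Finset.mul_sum]
    have h3 : (g n * ∑ m ∈ S, A m * B (n - m)) ^ 2 ≤ g n ^ 2 * (a * b) := by
      rw [mul_pow]; gcongr; exact h0 n
    have h1 := h1 n
    have h2 := h2 n
    set X := g n * ∑ m ∈ S, A m * B (n - m)
    set Y := ∑ m ∈ S, g m * (A m * B (n - m))
    set Z := ∑ m ∈ S, g (n - m) * (A m * B (n - m))
    nlinarith [sq_nonneg (X - Y), sq_nonneg (X - Z), sq_nonneg (Y - Z)]
  have hdouble : ∑ n ∈ N, ∑ m ∈ S, A m ^ 2 * B (n - m) ^ 2 ≤ a * b := by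
    rw [Finset.sum_comm]
    simp only [← Finset.mul_sum]
    calc ∑ m ∈ S, A m ^ 2 * ∑ n ∈ N, B (n - m) ^ 2 ≤ ∑ m ∈ S, A m ^ 2 * b := by
          gcongr with m
          exact sum_comp_sub_right_le (g := fun m => B m ^ 2) hB m N
      _ = (∑ m ∈ S, A m ^ 2) * b := by rw [Finset.sum_mul]
      _ ≤ a * b := by gcongr; exact hA S
  calc _ ≤ ∑ n ∈ N, (3 * (g n ^ 2 * (a * b)) + 6 * (z * ∑ m ∈ S, A m ^ 2 * B (n - m) ^ 2)) :=
        Finset.sum_le_sum fun n _ => hpt n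
    _ = 3 * ((∑ n ∈ N, g n ^ 2) * (a * b)) +
        6 * (z * ∑ n ∈ N, ∑ m ∈ S, A m ^ 2 * B (n - m) ^ 2) := by
        rw [Finset.sum_add_distrib, ← Finset.mul_sum, ← Finset.mul_sum, ← Finset.mul_sum,
          Finset.sum_mul]
    _ ≤ 3 * (z * (a * b)) + 6 * (z * (a * b)) := by
        gcongr
        exact hg N
    _ = _ := by ring

/-- `rpow_kernel_le` replaces the weight `⟨n⟩^{s₃} ⟨m⟩^{-s₁} ⟨n-m⟩^{-s₂}` by a sum of one-variable
weights `⟨·⟩^{-Γ}`, which are in `ℓ²(ℤ²)` because `Γ = s₁ + s₂ - s₃ > 1`. -/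
lemma Hs.exists_mul {s₁ s₂ s₃ : ℝ} (h₁ : 0 ≤ s₁) (h₂ : 0 ≤ s₂) (h₃₁ : s₃ ≤ s₁) (h₃₂ : s₃ ≤ s₂)
    (h : 1 < s₁ + s₂ - s₃) :
    ∃ B : Hs s₁ →L[ℂ] Hs s₂ →L[ℂ] Hs s₃, ∀ f g, (B f g).coeff = product f.coeff g.coeff := by
  set Γ := s₁ + s₂ - s₃ with hΓ
  have hsum := summable_bracket_rpow h
  set Z := ∑' n : Freq, (bracket n ^ (-Γ)) ^ 2
  have hZ : 0 ≤ Z := tsum_nonneg fun _ => sq_nonneg _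
  have hd : ∀ (f : Hs s₁) (g : Hs s₂), ProductDefined f.coeff g.coeff := fun f g =>
    productDefined_of_summable_sq (f.summable_norm_coeff_sq h₁) (g.summable_norm_coeff_sq h₂)
  refine exists_bilinear_product (Hs.coeffLM s₁) (Hs.coeffLM s₂) hd
    (C := 2 ^ |s₃| * Real.sqrt (9 * Z)) (by positivity) fun f g N => ?_
  refine partialSq_product_le (hd f g) (fun N S => ?_) N
  have hc := sum_sq_convolution_le (g := fun n => bracket n ^ (-Γ)) f.partialSq_le g.partialSq_le
    (fun S => hsum.sum_le_tsum S fun _ _ => sq_nonneg _) N S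
  calc _ ≤ ∑ n ∈ N, (2 ^ |s₃| * ∑ m ∈ S, (bracket n ^ (-Γ) + bracket m ^ (-Γ) +
        bracket (n - m) ^ (-Γ)) * ((bracket m ^ s₁ * ‖f.coeff m‖) *
        (bracket (n - m) ^ s₂ * ‖g.coeff (n - m)‖))) ^ 2 := by
        refine Finset.sum_le_sum fun n _ => ?_
        have := (bracket_rpow_pos n s₃).le
        refine pow_le_pow_left₀ (by positivity) ?_ 2
        refine (mul_le_mul_of_nonneg_left
          (norm_sum_le S fun m => f.coeff m * g.coeff (n - m)) this).trans ?_
        rw [Finset.mul_sum, Finset.mul_sum]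
        refine Finset.sum_le_sum fun m _ => ?_
        have hk := rpow_kernel_le (one_le_bracket n) (one_le_bracket m) (one_le_bracket (n - m))
          (by simpa using bracket_add_le m (n - m)) h₁ h₂ h₃₁ h₃₂
        have p1 := bracket_rpow_pos m s₁
        have p2 := bracket_rpow_pos (n - m) s₂
        rw [Real.rpow_neg (bracket_pos m).le, Real.rpow_neg (bracket_pos (n - m)).le s₂] at hk
        have hk' := mul_le_mul_of_nonneg_right hk (show 0 ≤ (bracket m ^ s₁ * ‖f.coeff m‖) *
          (bracket (n - m) ^ s₂ * ‖g.coeff (n - m)‖) by positivity)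
        refine le_trans (le_of_eq ?_) (hk'.trans (le_of_eq (by rw [mul_assoc])))
        rw [norm_mul]
        field_simp
    _ = (2 ^ |s₃|) ^ 2 * ∑ n ∈ N, (∑ m ∈ S, (bracket n ^ (-Γ) + bracket m ^ (-Γ) +
        bracket (n - m) ^ (-Γ)) * ((bracket m ^ s₁ * ‖f.coeff m‖) *
        (bracket (n - m) ^ s₂ * ‖g.coeff (n - m)‖))) ^ 2 := by
        rw [Finset.mul_sum]
        exact Finset.sum_congr rfl fun n _ => mul_pow _ _ _
    _ ≤ (2 ^ |s₃|) ^ 2 * (9 * (Z * (‖f‖ ^ 2 * ‖g‖ ^ 2))) := by gcongr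
    _ = _ := by
        rw [mul_pow, mul_pow, mul_pow, Real.sq_sqrt (by positivity)]
        ring

/-! ### Schur multipliers -/

/-- The matrix `K` defines an operator of norm at most `M` on `ℓ²(ℤ²)`. -/
def OpBound (K : Freq → Freq → ℂ) (M : ℝ) : Prop :=
  ∀ (b : Freq → ℂ) (N S : Finset Freq),
    ∑ n ∈ N, ‖∑ l ∈ S, K n l * b l‖ ^ 2 ≤ M ^ 2 * ∑ l ∈ S, ‖b l‖ ^ 2

/-- The new matrix is `∑ᵢ Dᵢ K Dᵢ` with diagonal `Dᵢ`. Since `∑ᵢ Dᵢ² ≤ 1`, the map `b ↦ (Dᵢ b)ᵢ` and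
its adjoint are contractions, so the operator norm does not grow. -/
lemma OpBound.mul_gram {ι : Type*} [Fintype ι] {K : Freq → Freq → ℂ} {M : ℝ} (hK : OpBound K M)
    (D : ι → Freq → ℝ) (hD : ∀ n, ∑ i, D i n ^ 2 ≤ 1) :
    OpBound (fun n l => ((∑ i, D i n * D i l : ℝ) : ℂ) * K n l) M := by
  intro b N S
  have hrow : ∀ n, ‖∑ l ∈ S, ((∑ i, D i n * D i l : ℝ) : ℂ) * K n l * b l‖ ^ 2 ≤
      ∑ i, ‖∑ l ∈ S, K n l * ((D i l : ℂ) * b l)‖ ^ 2 := by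
    intro n
    have e : ∑ l ∈ S, ((∑ i, D i n * D i l : ℝ) : ℂ) * K n l * b l =
        ∑ i, (D i n : ℂ) * ∑ l ∈ S, K n l * ((D i l : ℂ) * b l) := by
      simp only [Finset.mul_sum, Complex.ofReal_sum, Complex.ofReal_mul, Finset.sum_mul]
      rw [Finset.sum_comm]
      refine Finset.sum_congr rfl fun i _ => Finset.sum_congr rfl fun l _ => ?_
      ring
    have hle : ‖∑ l ∈ S, ((∑ i, D i n * D i l : ℝ) : ℂ) * K n l * b l‖ ≤
        ∑ i, |D i n| * ‖∑ l ∈ S, K n l * ((D i l : ℂ) * b l)‖ := by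
      rw [e]
      refine (norm_sum_le _ _).trans (le_of_eq ?_)
      refine Finset.sum_congr rfl fun i _ => ?_
      rw [norm_mul, Complex.norm_real, Real.norm_eq_abs]
    refine (pow_le_pow_left₀ (norm_nonneg _) hle 2).trans ?_
    refine (Finset.sum_mul_sq_le_sq_mul_sq _ _ _).trans ?_
    simp only [sq_abs]
    exact mul_le_of_le_one_left (Finset.sum_nonneg fun _ _ => sq_nonneg _) (hD n)
  calc _ ≤ ∑ n ∈ N, ∑ i, ‖∑ l ∈ S, K n l * ((D i l : ℂ) * b l)‖ ^ 2 :=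
        Finset.sum_le_sum fun n _ => hrow n
    _ = ∑ i, ∑ n ∈ N, ‖∑ l ∈ S, K n l * ((D i l : ℂ) * b l)‖ ^ 2 := Finset.sum_comm
    _ ≤ ∑ i, M ^ 2 * ∑ l ∈ S, ‖(D i l : ℂ) * b l‖ ^ 2 :=
        Finset.sum_le_sum fun i _ => hK _ N S
    _ = M ^ 2 * ∑ l ∈ S, (∑ i, D i l ^ 2) * ‖b l‖ ^ 2 := by
        rw [← Finset.mul_sum, Finset.sum_comm]
        congr 1
        refine Finset.sum_congr rfl fun l _ => ?_
        rw [Finset.sum_mul]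
        refine Finset.sum_congr rfl fun i _ => ?_
        rw [norm_mul, Complex.norm_real, Real.norm_eq_abs, mul_pow, sq_abs]
    _ ≤ M ^ 2 * ∑ l ∈ S, ‖b l‖ ^ 2 := by
        gcongr with l
        exact mul_le_of_le_one_left (sq_nonneg _) (hD l)

lemma OpBound.mul_gram_pow {ι : Type*} [Fintype ι] {K : Freq → Freq → ℂ} {M : ℝ}
    (hK : OpBound K M) (D : ι → Freq → ℝ) (hD : ∀ n, ∑ i, D i n ^ 2 ≤ 1) (j : ℕ) :
    OpBound (fun n l => (((∑ i, D i n * D i l) ^ j : ℝ) : ℂ) * K n l) M := by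
  induction j with
  | zero => simpa using hK
  | succ j ih =>
    have e : (fun n l => (((∑ i, D i n * D i l) ^ (j + 1) : ℝ) : ℂ) * K n l) =
        fun n l => ((∑ i, D i n * D i l : ℝ) : ℂ) *
          ((((∑ i, D i n * D i l) ^ j : ℝ) : ℂ) * K n l) := by
      funext n l
      rw [pow_succ', Complex.ofReal_mul, mul_assoc]
    rw [e]
    exact ih.mul_gram D hD

/-- This is the triangle inequality for operator norms, carried out on finite sections: splitting
`|α j|` into two square roots and applying Cauchy–Schwarz keeps the estimate in squared form. -/
lemma OpBound.hasSum {K : Freq → Freq → ℂ} {M : ℝ} {q : ℕ → Freq → Freq → ℝ}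
    {m : Freq → Freq → ℝ} (hK : ∀ j, OpBound (fun n l => (q j n l : ℂ) * K n l) M) {α : ℕ → ℝ}
    (hα : Summable fun j => |α j|) (hm : ∀ n l, HasSum (fun j => α j * q j n l) (m n l)) :
    OpBound (fun n l => (m n l : ℂ) * K n l) ((∑' j, |α j|) * M) := by
  intro b N S
  set A := ∑' j, |α j| with hA
  have hA0 : 0 ≤ A := tsum_nonneg fun _ => abs_nonneg _
  set c : ℕ → Freq → ℂ := fun j n => ∑ l ∈ S, (q j n l : ℂ) * K n l * b l with hc
  have hlim : ∀ n, HasSum (fun j => (α j : ℂ) * c j n) (∑ l ∈ S, (m n l : ℂ) * K n l * b l) := by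
    intro n
    have := hasSum_sum (s := S) fun l _ =>
      ((Complex.hasSum_ofReal.2 (hm n l)).mul_right (K n l * b l))
    have e1 : (fun j => (α j : ℂ) * c j n) =
        fun j => ∑ l ∈ S, ((α j * q j n l : ℝ) : ℂ) * (K n l * b l) := by
      funext j
      simp only [hc, Finset.mul_sum, Complex.ofReal_mul]
      exact Finset.sum_congr rfl fun l _ => by ring
    simp only [mul_assoc] at e1 ⊢
    rw [e1]
    exact this
  refine le_of_tendsto' (x := (atTop : Filter (Finset ℕ)))
    (tendsto_finsetSum N fun n _ => ((hlim n).norm).pow 2) fun J => ?_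
  have hJ : ∑ j ∈ J, |α j| ≤ A := hα.sum_le_tsum J fun _ _ => abs_nonneg _
  have hrow : ∀ n, ‖∑ j ∈ J, (α j : ℂ) * c j n‖ ^ 2 ≤ A * ∑ j ∈ J, |α j| * ‖c j n‖ ^ 2 := by
    intro n
    have h1 : ‖∑ j ∈ J, (α j : ℂ) * c j n‖ ≤
        ∑ j ∈ J, Real.sqrt |α j| * (Real.sqrt |α j| * ‖c j n‖) := by
      refine (norm_sum_le _ _).trans (le_of_eq (Finset.sum_congr rfl fun j _ => ?_))
      rw [norm_mul, Complex.norm_real, Real.norm_eq_abs, ← mul_assoc,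
        Real.mul_self_sqrt (abs_nonneg _)]
    refine (pow_le_pow_left₀ (norm_nonneg _) h1 2).trans ?_
    refine (Finset.sum_mul_sq_le_sq_mul_sq _ _ _).trans ?_
    simp only [mul_pow, Real.sq_sqrt (abs_nonneg _)]
    have : 0 ≤ ∑ j ∈ J, |α j| * ‖c j n‖ ^ 2 := Finset.sum_nonneg fun _ _ => by positivity
    gcongr
  calc _ ≤ ∑ n ∈ N, A * ∑ j ∈ J, |α j| * ‖c j n‖ ^ 2 := Finset.sum_le_sum fun n _ => hrow n
    _ = A * ∑ j ∈ J, |α j| * ∑ n ∈ N, ‖c j n‖ ^ 2 := by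
        rw [← Finset.mul_sum, Finset.sum_comm]
        simp only [Finset.mul_sum]
    _ ≤ A * ∑ j ∈ J, |α j| * (M ^ 2 * ∑ l ∈ S, ‖b l‖ ^ 2) := by
        gcongr with j
        exact hK j b N S
    _ = A * ((∑ j ∈ J, |α j|) * (M ^ 2 * ∑ l ∈ S, ‖b l‖ ^ 2)) := by rw [Finset.sum_mul]
    _ ≤ A * (A * (M ^ 2 * ∑ l ∈ S, ‖b l‖ ^ 2)) := by
        have : 0 ≤ ∑ l ∈ S, ‖b l‖ ^ 2 := Finset.sum_nonneg fun _ _ => sq_nonneg _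
        gcongr
    _ = _ := by ring

/-! ### The binomial series with a small positive exponent -/

lemma choose_succ_mul (p : ℝ) (j : ℕ) :
    ((j : ℝ) + 1) * Ring.choose p (j + 1) = Ring.choose p j * (p - j) := by
  have h := Ring.choose_smul_choose p (Nat.le_succ j)
  rw [Nat.succ_eq_add_one, Nat.add_sub_cancel_left, Ring.choose_one_right,
    Nat.choose_succ_self_right, nsmul_eq_mul] at h
  exact_mod_cast h

/-- The first coefficient is `-p`, and each later one is the previous one times `(j + 1 - p)/(j +
2)`, which is nonnegative because `p ≤ 1`. -/
lemma binomialCoeff_nonpos {p : ℝ} (hp : 0 < p) (hp1 : p ≤ 1) (j : ℕ) :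
    (-1) ^ (j + 1) * Ring.choose p (j + 1) ≤ 0 := by
  induction j with
  | zero => simp; exact hp.le
  | succ j ih =>
    have h := choose_succ_mul p (j + 1)
    have hj : p - ((j + 1 : ℕ) : ℝ) ≤ 0 := by push_cast; linarith [(Nat.cast_nonneg j : (0 : ℝ) ≤ j)]
    have hpos : (0 : ℝ) < ((j + 1 : ℕ) : ℝ) + 1 := by positivity
    refine nonpos_of_mul_nonpos_right (a := ((j + 1 : ℕ) : ℝ) + 1) ?_ hpos
    have e : (((j + 1 : ℕ) : ℝ) + 1) * ((-1) ^ (j + 1 + 1) * Ring.choose p (j + 1 + 1)) =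
        -(p - ((j + 1 : ℕ) : ℝ)) * ((-1) ^ (j + 1) * Ring.choose p (j + 1)) := by
      rw [mul_left_comm, h]; ring
    rw [e]
    exact mul_nonpos_of_nonneg_of_nonpos (by linarith) ih

lemma hasSum_one_sub_rpow (p : ℝ) {q : ℝ} (hq : |q| < 1) :
    HasSum (fun j : ℕ => (-1) ^ j * Ring.choose p j * q ^ j) ((1 - q) ^ p) := by
  have h := (Real.one_add_rpow_hasFPowerSeriesOnBall_zero (a := p)).hasSum (y := -q) (by
    simpa [enorm_eq_nnnorm, ← NNReal.coe_lt_coe] using hq)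
  rw [zero_add, ← sub_eq_add_neg] at h
  have e : (fun j : ℕ => (-1) ^ j * Ring.choose p j * q ^ j) =
      fun j => (binomialSeries ℝ p j) fun _ => -q := by
    funext j
    rw [binomialSeries_apply, List.ofFn_const, List.prod_replicate, neg_pow q j, smul_eq_mul]
    ring
  rw [e]
  exact h

/-- All coefficients after the first have the same sign, so for `0 < q < 1` their absolute values
weighted by powers of `q` sum to `1 - (1 - q)^p ≤ 1`. Letting `q → 1` in finite sums gives the
bound. -/
lemma summable_abs_binomialCoeff {p : ℝ} (hp : 0 < p) (hp1 : p ≤ 1) :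
    Summable fun j : ℕ => |(-1) ^ j * Ring.choose p j| := by
  rw [← summable_nat_add_iff 1]
  refine summable_of_sum_range_le (c := 1) (fun _ => abs_nonneg _) fun J => ?_
  have hq : ∀ q ∈ Set.Ioo (0 : ℝ) 1,
      ∑ j ∈ Finset.range J, |(-1) ^ (j + 1) * Ring.choose p (j + 1)| * q ^ (j + 1) ≤ 1 := by
    intro q hq
    have h := hasSum_one_sub_rpow p (q := q) (by rw [abs_of_pos hq.1]; exact hq.2)
    have h1 := (hasSum_nat_add_iff' 1).2 h
    simp only [Finset.range_one, Finset.sum_singleton, pow_zero, Ring.choose_zero_right,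
      mul_one] at h1
    have h2 := sum_le_hasSum (Finset.range J) (fun j _ => ?_) h1.neg
    · have h3 : 0 ≤ (1 - q) ^ p := Real.rpow_nonneg (by linarith [hq.2]) _
      refine le_trans (le_of_eq (Finset.sum_congr rfl fun j _ => ?_)) (h2.trans (by linarith))
      rw [abs_of_nonpos (binomialCoeff_nonpos hp hp1 j)]
      ring
    · have := mul_nonpos_of_nonpos_of_nonneg (binomialCoeff_nonpos hp hp1 j)
        (pow_nonneg hq.1.le (j + 1))
      linarith
  have hcont : Tendsto (fun q : ℝ => ∑ j ∈ Finset.range J,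
      |(-1) ^ (j + 1) * Ring.choose p (j + 1)| * q ^ (j + 1)) (𝓝[<] 1)
      (𝓝 (∑ j ∈ Finset.range J, |(-1) ^ (j + 1) * Ring.choose p (j + 1)| * 1 ^ (j + 1))) := by
    refine tendsto_nhdsWithin_of_tendsto_nhds (Continuous.tendsto ?_ 1)
    fun_prop
  have := le_of_tendsto hcont (by
    filter_upwards [Ioo_mem_nhdsLT (show (0 : ℝ) < 1 by norm_num)] with q h using hq q h)
  simpa using this

/-! ### Conjugating by powers of the bracket -/

/-- Real vectors `(D i n)ᵢ` with `1 - ∑ᵢ D i n * D i l = ⟨n - l⟩² / (2 ⟨n⟩² ⟨l⟩²)`. -/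
noncomputable def gramVec (i : Fin 4) (n : Freq) : ℝ :=
  ![Real.sqrt (1 / 2), Real.sqrt (1 / 2) * (1 - (bracket n ^ 2)⁻¹),
    n 0 * (bracket n ^ 2)⁻¹, n 1 * (bracket n ^ 2)⁻¹] i

lemma sum_gramVec_mul (n l : Freq) :
    ∑ i, gramVec i n * gramVec i l =
      1 - bracket (n - l) ^ 2 / (2 * bracket n ^ 2 * bracket l ^ 2) := by
  have h : Real.sqrt (1 / 2) * Real.sqrt (1 / 2) = 1 / 2 := Real.mul_self_sqrt (by norm_num)
  have hn := (pow_pos (bracket_pos n) 2).ne'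
  have hl := (pow_pos (bracket_pos l) 2).ne'
  have e : bracket (n - l) ^ 2 =
      bracket n ^ 2 + bracket l ^ 2 - 1 - 2 * (n 0 * l 0 + n 1 * l 1) := by
    rw [bracket_sq, bracket_sq, bracket_sq]
    simp only [Pi.sub_apply, Int.cast_sub]
    ring
  rw [e]
  simp only [Fin.sum_univ_four, gramVec]
  simp only [Matrix.cons_val]
  calc _ = (Real.sqrt (1 / 2) * Real.sqrt (1 / 2)) *
        (1 + (1 - (bracket n ^ 2)⁻¹) * (1 - (bracket l ^ 2)⁻¹)) +
        (n 0 * l 0 + n 1 * l 1) * ((bracket n ^ 2)⁻¹ * (bracket l ^ 2)⁻¹) := by ring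
    _ = _ := by
      rw [h]
      generalize bracket n ^ 2 = x at hn ⊢
      generalize bracket l ^ 2 = y at hl ⊢
      field_simp
      ring

lemma sum_gramVec_sq (n : Freq) : ∑ i, gramVec i n ^ 2 < 1 := by
  have h := sum_gramVec_mul n n
  simp only [← pow_two] at h
  rw [h, sub_self]
  have : 0 < bracket 0 ^ 2 / (2 * bracket n ^ 2 * bracket n ^ 2) := by
    have := bracket_pos n
    have := bracket_pos 0
    positivity
  linarith

/-- Strictness puts the Gram kernel inside the disc of convergence of the binomial series at every
pair of frequencies; no uniform gap is needed, since the coefficients are absolutely summable. -/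
lemma abs_sum_gramVec_mul_lt (n l : Freq) : |∑ i, gramVec i n * gramVec i l| < 1 := by
  have h := Finset.sum_mul_sq_le_sq_mul_sq Finset.univ (gramVec · n) (gramVec · l)
  have hn := sum_gramVec_sq n
  have hl := sum_gramVec_sq l
  have hn0 : 0 ≤ ∑ i, gramVec i n ^ 2 := Finset.sum_nonneg fun _ _ => sq_nonneg _
  have hl0 : 0 ≤ ∑ i, gramVec i l ^ 2 := Finset.sum_nonneg fun _ _ => sq_nonneg _
  rw [← sq_lt_one_iff_abs_lt_one]
  nlinarith

/-- By the choice of `gramVec` the weight equals `2^{θ/2} (1 - G)^{θ/2}` with `G` the Gram kernel.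
Expanding in powers of `G`, each a contractive Schur multiplier, costs only the `ℓ¹` norm of the
binomial coefficients. -/
lemma OpBound.bracket_rpow {K : Freq → Freq → ℂ} {M θ : ℝ} (hK : OpBound K M) (hθ : 0 < θ)
    (hθ2 : θ ≤ 2) :
    OpBound (fun n l => ((bracket n ^ (-θ) * bracket (n - l) ^ θ * bracket l ^ (-θ) : ℝ) : ℂ) *
      K n l) (2 ^ (θ / 2) * (∑' j : ℕ, |(-1) ^ j * Ring.choose (θ / 2) j|) * M) := by
  have h := OpBound.hasSum (fun j => hK.mul_gram_pow gramVec (fun n => (sum_gramVec_sq n).le) j)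
    (summable_abs_binomialCoeff (p := θ / 2) (by linarith) (by linarith))
    (fun n l => hasSum_one_sub_rpow (θ / 2) (abs_sum_gramVec_mul_lt n l))
  intro b N S
  have e : ∀ n l, bracket n ^ (-θ) * bracket (n - l) ^ θ * bracket l ^ (-θ) =
      2 ^ (θ / 2) * (1 - ∑ i, gramVec i n * gramVec i l) ^ (θ / 2) := by
    intro n l
    have pn := bracket_pos n
    have pl := bracket_pos l
    have pnl := bracket_pos (n - l)
    rw [sum_gramVec_mul, sub_sub_cancel, ← Real.mul_rpow (by positivity) (by positivity)]
    have : 2 * (bracket (n - l) ^ 2 / (2 * bracket n ^ 2 * bracket l ^ 2)) =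
        ((bracket n)⁻¹ * bracket (n - l) * (bracket l)⁻¹) ^ 2 := by
      field_simp
    rw [this, ← Real.rpow_natCast, ← Real.rpow_mul (by positivity), Nat.cast_ofNat,
      mul_div_cancel₀ _ two_ne_zero, Real.mul_rpow (by positivity) (by positivity),
      Real.mul_rpow (by positivity) (by positivity), Real.inv_rpow pn.le, Real.inv_rpow pl.le,
      Real.rpow_neg pn.le, Real.rpow_neg pl.le]
  have h2 := mul_le_mul_of_nonneg_left (h b N S) (sq_nonneg ((2 : ℝ) ^ (θ / 2)))
  refine le_trans (le_of_eq ?_) (h2.trans (le_of_eq (by ring)))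
  rw [Finset.mul_sum]
  refine Finset.sum_congr rfl fun n _ => ?_
  have hnorm : ‖((2 ^ (θ / 2) : ℝ) : ℂ)‖ = 2 ^ (θ / 2) :=
    Complex.norm_of_nonneg (by positivity)
  rw [← hnorm, ← mul_pow, ← norm_mul, Finset.mul_sum]
  congr 2
  refine Finset.sum_congr rfl fun l _ => ?_
  beta_reduce
  rw [e, Complex.ofReal_mul]
  ring

section BoundedMultiplier

open UnitAddTorus

/-! ### Multiplication by a bounded function -/

lemma norm_sum_mFourierLp_sq (b : Freq → ℂ) (S : Finset Freq) :
    ‖∑ l ∈ S, b l • mFourierLp (d := Fin 2) 2 l‖ ^ 2 = ∑ l ∈ S, ‖b l‖ ^ 2 := by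
  have h := (orthonormal_mFourier (d := Fin 2)).inner_sum b b S
  rw [inner_self_eq_norm_sq_to_K] at h
  have h' : ((‖∑ l ∈ S, b l • mFourierLp (d := Fin 2) 2 l‖ ^ 2 : ℝ) : ℂ) =
      ((∑ l ∈ S, ‖b l‖ ^ 2 : ℝ) : ℂ) := by
    push_cast
    refine Eq.trans h (Finset.sum_congr rfl fun l _ => ?_)
    exact Complex.conj_mul' (b l)
  exact_mod_cast h'

lemma sum_mFourierCoeff_sq_le {h : UnitAddTorus (Fin 2) → ℂ} (hh : MemLp h 2 torusMeasure)
    (N : Finset Freq) :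
    ∑ n ∈ N, ‖mFourierCoeff h n‖ ^ 2 ≤ (eLpNorm h 2 torusMeasure).toReal ^ 2 := by
  have hr : ∀ n, mFourierCoeff h n =
      ((mFourierBasis (d := Fin 2)).repr (hh.toLp h) : Freq → ℂ) n := by
    intro n
    refine Eq.trans ?_ (mFourierBasis_repr (d := Fin 2) (hh.toLp h) n).symm
    refine integral_congr_ae (μ := torusMeasure) ?_
    filter_upwards [hh.coeFn_toLp] with y hy
    exact congrArg (fun z => mFourier (-n) y • z) hy.symm
  have hB := lp.sum_rpow_le_norm_rpow (p := 2) (by simp)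
    ((mFourierBasis (d := Fin 2)).repr (hh.toLp h)) N
  rw [LinearIsometryEquiv.norm_map] at hB
  simp only [ENNReal.toReal_ofNat, Real.rpow_two] at hB
  simp only [hr]
  refine hB.trans (le_of_eq ?_)
  congr 1
  exact Lp.norm_toLp h hh

/-- In Fourier variables this matrix is multiplication by `g`: Bessel's inequality for `g u`, with
`u` the trigonometric polynomial of coefficients `b`, and `‖g u‖₂ ≤ ‖g‖_∞ ‖u‖₂`. -/
lemma opBound_mFourierCoeff (g : Lp ℂ ∞ torusMeasure) :
    OpBound (fun n l => mFourierCoeff g (n - l)) ‖g‖ := by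
  intro b N S
  set U : Lp ℂ 2 torusMeasure := ∑ l ∈ S, b l • mFourierLp (d := Fin 2) 2 l with hU
  set u : UnitAddTorus (Fin 2) → ℂ := fun y => ∑ l ∈ S, b l * mFourier l y with hu
  have hucont : Continuous u := by
    refine continuous_finsetSum _ fun l _ => ?_
    exact continuous_const.mul (mFourier l).continuous
  have hUu : (U : UnitAddTorus (Fin 2) → ℂ) =ᵐ[torusMeasure] u := by
    have h1 := Lp.coeFn_finsetSum S fun l => b l • (mFourierLp (d := Fin 2) 2 l)
    have h2 : ∀ l ∈ S, ∀ᵐ y ∂torusMeasure,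
        (b l • (mFourierLp (d := Fin 2) 2 l) : Lp ℂ 2 torusMeasure) y = b l * mFourier l y := by
      intro l _
      filter_upwards [Lp.coeFn_smul (b l) (mFourierLp (d := Fin 2) 2 l),
        coeFn_mFourierLp (d := Fin 2) 2 l] with y h3 h4
      refine h3.trans ?_
      rw [Pi.smul_apply, h4, smul_eq_mul]
    filter_upwards [h1, (ae_ball_iff S.countable_toSet).2 h2] with y h3 h4
    refine h3.trans ?_
    rw [Finset.sum_apply]
    exact Finset.sum_congr rfl fun l hl => h4 l hl
  have hu2 : MemLp u 2 torusMeasure := (memLp_congr_ae hUu).1 (Lp.memLp U)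
  have hgu : MemLp ((g : UnitAddTorus (Fin 2) → ℂ) • u) 2 torusMeasure :=
    hu2.smul (r := 2) (p := ∞) (q := 2) (Lp.memLp g)
  have hcoef : ∀ n, mFourierCoeff ((g : UnitAddTorus (Fin 2) → ℂ) • u) n =
      ∑ l ∈ S, mFourierCoeff g (n - l) * b l := by
    intro n
    have hint : ∀ l ∈ S, Integrable (fun y => (mFourier (-(n - l)) y • g y) * b l)
        torusMeasure := fun l _ =>
      (((Lp.memLp g).integrable le_top).bdd_mul (c := 1)
        (mFourier (-(n - l))).continuous.aestronglyMeasurable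
        (Filter.Eventually.of_forall fun y =>
          ((mFourier (-(n - l))).norm_coe_le_norm y).trans mFourier_norm.le)).mul_const _
    have h1 : ∫ y, mFourier (-n) y • ((g : UnitAddTorus (Fin 2) → ℂ) • u) y ∂torusMeasure =
        ∑ l ∈ S, ∫ y, (mFourier (-(n - l)) y • g y) * b l ∂torusMeasure := by
      rw [← integral_finsetSum S hint]
      refine integral_congr_ae (Filter.Eventually.of_forall fun y => ?_)
      simp only [hu, Pi.smul_apply', smul_eq_mul, Finset.mul_sum]
      refine Finset.sum_congr rfl fun l _ => ?_
      rw [show -(n - l) = -n + l by abel, mFourier_add]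
      ring
    refine Eq.trans h1 (Finset.sum_congr rfl fun l _ => ?_)
    exact integral_mul_const (μ := torusMeasure) _ _
  have hle := sum_mFourierCoeff_sq_le hgu N
  simp only [hcoef] at hle
  refine hle.trans ?_
  rw [← norm_sum_mFourierLp_sq, ← mul_pow]
  refine pow_le_pow_left₀ ENNReal.toReal_nonneg ?_ 2
  have hn := eLpNorm_smul_le_eLpNorm_top_mul_eLpNorm (μ := torusMeasure) 2
    hu2.aestronglyMeasurable (g : UnitAddTorus (Fin 2) → ℂ)
  refine (ENNReal.toReal_mono (ENNReal.mul_ne_top (Lp.eLpNorm_ne_top g) hu2.2.ne) hn).trans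
    (le_of_eq ?_)
  rw [ENNReal.toReal_mul, ← eLpNorm_congr_ae hUu]
  rfl

end BoundedMultiplier

/-! ### Products of elements of `W^{-θ,∞}` and `H^θ` -/

namespace WInf

open UnitAddTorus

lemma norm_eq {s : ℝ} (f : WInf s) : ‖f‖ = ‖toLinf s f‖ := rfl

lemma coeff_eq {s : ℝ} (f : WInf s) (n : Freq) :
    f.coeff n = ((bracket n ^ (-s) : ℝ) : ℂ) * mFourierCoeff (toLinf s f) n := by
  have h := LinearEquiv.apply_symm_apply
    (LinearEquiv.ofInjective (besselLinf s) (besselLinf_injective s)) f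
  exact (congrFun (congrArg Subtype.val h) n).symm

/-- With `ξ̂ = ⟨·⟩^θ ĝ` and the vector `⟨l⟩^θ f̂(l)` in `ℓ²`, the estimate is the bound on the
conjugated matrix of multiplication by `g`. -/
lemma sum_sq_convolution_le {θ : ℝ} (hθ : 0 < θ) (hθ2 : θ ≤ 2) (ξ : WInf (-θ)) (f : Hs θ)
    (N S : Finset Freq) :
    ∑ n ∈ N, (bracket n ^ (-θ) * ‖∑ l ∈ S, f.coeff l * ξ.coeff (n - l)‖) ^ 2 ≤
      (2 ^ (θ / 2) * (∑' j : ℕ, |(-1) ^ j * Ring.choose (θ / 2) j|) * ‖ξ‖ * ‖f‖) ^ 2 := by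
  set C := 2 ^ (θ / 2) * (∑' j : ℕ, |(-1) ^ j * Ring.choose (θ / 2) j|)
  have h := (opBound_mFourierCoeff (toLinf (-θ) ξ)).bracket_rpow hθ hθ2
    (fun l => ((bracket l ^ θ : ℝ) : ℂ) * f.coeff l) N S
  rw [← norm_eq] at h
  have hf : ∑ l ∈ S, ‖((bracket l ^ θ : ℝ) : ℂ) * f.coeff l‖ ^ 2 ≤ ‖f‖ ^ 2 := by
    refine le_trans (le_of_eq (Finset.sum_congr rfl fun l _ => ?_)) (f.partialSq_le S)
    rw [norm_mul, Complex.norm_of_nonneg (bracket_rpow_pos l θ).le]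
  refine le_trans (le_of_eq (Finset.sum_congr rfl fun n _ => ?_))
    (h.trans ((mul_le_mul_of_nonneg_left hf (sq_nonneg _)).trans (le_of_eq (mul_pow _ _ _).symm)))
  rw [← Complex.norm_of_nonneg (bracket_rpow_pos n (-θ)).le, ← norm_mul, Finset.mul_sum]
  congr 2
  refine Finset.sum_congr rfl fun l _ => ?_
  have hl : ((bracket l ^ (-θ) : ℝ) : ℂ) * ((bracket l ^ θ : ℝ) : ℂ) = 1 := by
    rw [← Complex.ofReal_mul, ← Real.rpow_add (bracket_pos l), neg_add_cancel, Real.rpow_zero,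
      Complex.ofReal_one]
  rw [ξ.coeff_eq, neg_neg]
  push_cast at hl ⊢
  linear_combination (-1 : ℂ) * ((bracket n ^ (-θ) : ℝ) : ℂ) * f.coeff l *
    ((bracket (n - l) ^ θ : ℝ) : ℂ) * mFourierCoeff (toLinf (-θ) ξ) (n - l) * hl

lemma summable_weighted_coeff_sq {θ : ℝ} (ξ : WInf (-θ)) :
    Summable fun n => (bracket n ^ (-θ) * ‖ξ.coeff n‖) ^ 2 := by
  have h2 : MemLp (toLinf (-θ) ξ) 2 torusMeasure := (Lp.memLp _).mono_exponent le_top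
  refine summable_of_sum_le (c := (eLpNorm (toLinf (-θ) ξ) 2 torusMeasure).toReal ^ 2)
    (fun _ => sq_nonneg _) fun S => ?_
  refine le_trans (le_of_eq (Finset.sum_congr rfl fun n _ => ?_)) (sum_mFourierCoeff_sq_le h2 S)
  rw [ξ.coeff_eq, neg_neg, norm_mul, Complex.norm_of_nonneg (bracket_rpow_pos n θ).le, ← mul_assoc,
    ← Real.rpow_add (bracket_pos n), neg_add_cancel, Real.rpow_zero, one_mul]

/-- Since `L^∞ ⊂ L²`, `ξ` lies in `H^{-θ}`, and Peetre's inequality `⟨n-m⟩ ≤ 2⟨n⟩⟨m⟩` reduces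
absolute convergence to the pairing of `H^θ` with `H^{-θ}`. -/
lemma productDefined {θ : ℝ} (hθ : 0 ≤ θ) (ξ : WInf (-θ)) (f : Hs θ) :
    ProductDefined f.coeff ξ.coeff := by
  intro n
  have hf : Summable fun m => (bracket m ^ θ * ‖f.coeff m‖) ^ 2 :=
    summable_of_sum_le (fun _ => sq_nonneg _) f.partialSq_le
  have hξ : Summable fun m => (bracket (n - m) ^ (-θ) * ‖ξ.coeff (n - m)‖) ^ 2 := by
    simpa [Function.comp_def] using ((Equiv.subLeft n).summable_iff).2 ξ.summable_weighted_coeff_sq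
  refine Summable.of_nonneg_of_le (fun _ => norm_nonneg _) (fun m => ?_)
    ((hf.add hξ).mul_left ((2 * bracket n) ^ θ))
  have pm := bracket_pos m
  have pn := bracket_pos n
  have pnm := bracket_pos (n - m)
  have hle : bracket (n - m) ≤ 2 * bracket n * bracket m := by
    have h1 : bracket (n - m) ≤ bracket n + bracket m := by
      simpa [sub_eq_add_neg, bracket_neg] using bracket_add_le n (-m)
    nlinarith [one_le_bracket n, one_le_bracket m]
  have h1 : 1 ≤ (2 * bracket n) ^ θ * (bracket m ^ θ * bracket (n - m) ^ (-θ)) := by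
    rw [← mul_assoc, ← Real.mul_rpow (by positivity) pm.le, Real.rpow_neg pnm.le,
      ← div_eq_mul_inv, one_le_div (by positivity)]
    exact Real.rpow_le_rpow pnm.le hle hθ
  set X := bracket m ^ θ * ‖f.coeff m‖ with hX
  set Y := bracket (n - m) ^ (-θ) * ‖ξ.coeff (n - m)‖ with hY
  calc ‖f.coeff m * ξ.coeff (n - m)‖
      ≤ (2 * bracket n) ^ θ * (bracket m ^ θ * bracket (n - m) ^ (-θ)) *
        ‖f.coeff m * ξ.coeff (n - m)‖ := le_mul_of_one_le_left (norm_nonneg _) h1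
    _ = (2 * bracket n) ^ θ * (X * Y) := by rw [norm_mul, hX, hY]; ring
    _ ≤ (2 * bracket n) ^ θ * (X ^ 2 + Y ^ 2) := by
        gcongr
        nlinarith [sq_nonneg (X - Y), sq_nonneg X, sq_nonneg Y]

/-- Multiplication of `H^θ` by `W^{-θ,∞}`, with values in `H^{-θ}`. -/
lemma exists_mul {θ : ℝ} (hθ : 0 < θ) (hθ2 : θ ≤ 2) :
    ∃ B : WInf (-θ) →L[ℂ] Hs θ →L[ℂ] Hs (-θ),
      ∀ ξ f, (B ξ f).coeff = product ξ.coeff f.coeff := by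
  refine exists_bilinear_product (coeffLM (-θ)) (Hs.coeffLM θ)
    (fun ξ f => (productDefined hθ.le ξ f).symm)
    (C := 2 ^ (θ / 2) * (∑' j : ℕ, |(-1) ^ j * Ring.choose (θ / 2) j|))
    (mul_nonneg (by positivity) (tsum_nonneg fun _ => abs_nonneg _)) fun ξ f N => ?_
  rw [product_comm]
  exact partialSq_product_le (productDefined hθ.le ξ f) (sum_sq_convolution_le hθ hθ2 ξ f) N

end WInf

/-! ### Maps that are Lipschitz on bounded sets -/

/-- `f` is Lipschitz on every ball. -/
def LipBdd {E F : Type*} [SeminormedAddCommGroup E] [SeminormedAddCommGroup F] (f : E → F) : Prop :=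
  ∀ R : ℝ, ∃ C : ℝ, 0 ≤ C ∧ ∀ x y, ‖x‖ ≤ R → ‖y‖ ≤ R → ‖f x - f y‖ ≤ C * ‖x - y‖

namespace LipBdd

variable {E F G H : Type*} [NormedAddCommGroup E] [NormedAddCommGroup F] [NormedAddCommGroup G]
  [NormedAddCommGroup H]

lemma exists_norm_le {f : E → F} (hf : LipBdd f) (R : ℝ) :
    ∃ M : ℝ, 0 ≤ M ∧ ∀ x, ‖x‖ ≤ R → ‖f x‖ ≤ M := by
  obtain ⟨C, hC, h⟩ := hf (max R 0)
  refine ⟨C * max R 0 + ‖f 0‖, by positivity, fun x hx => ?_⟩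
  have h1 := h x 0 (hx.trans (le_max_left _ _)) (by simp)
  rw [sub_zero] at h1
  have h2 : ‖f x‖ ≤ ‖f x - f 0‖ + ‖f 0‖ := by simpa using norm_add_le (f x - f 0) (f 0)
  have h3 : C * ‖x‖ ≤ C * max R 0 := by gcongr; exact hx.trans (le_max_left _ _)
  linarith

lemma const (c : F) : LipBdd fun _ : E => c := fun _ => ⟨0, le_rfl, fun _ _ _ _ => by simp⟩

lemma clm [NormedSpace ℂ E] [NormedSpace ℂ F] (A : E →L[ℂ] F) : LipBdd A :=
  fun _ => ⟨‖A‖, norm_nonneg _, fun x y _ _ => by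
  rw [← map_sub]; exact A.le_opNorm _⟩

lemma add {f g : E → F} (hf : LipBdd f) (hg : LipBdd g) : LipBdd fun x => f x + g x := by
  intro R
  obtain ⟨C, hC, h⟩ := hf R
  obtain ⟨D, hD, h'⟩ := hg R
  refine ⟨C + D, by positivity, fun x y hx hy => ?_⟩
  rw [add_sub_add_comm, add_mul]
  exact (norm_add_le _ _).trans (add_le_add (h x y hx hy) (h' x y hx hy))

lemma sum {ι : Type*} (S : Finset ι) {f : ι → E → F} (hf : ∀ i ∈ S, LipBdd (f i)) :
    LipBdd fun x => ∑ i ∈ S, f i x := by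
  classical
  induction S using Finset.induction_on with
  | empty => simpa using const 0
  | insert i S hi ih =>
    simp only [Finset.sum_insert hi]
    exact (hf i (Finset.mem_insert_self _ _)).add
      (ih fun j hj => hf j (Finset.mem_insert_of_mem hj))

lemma comp {f : E → F} {g : F → G} (hg : LipBdd g) (hf : LipBdd f) :
    LipBdd fun x => g (f x) := by
  intro R
  obtain ⟨C, hC, h⟩ := hf R
  obtain ⟨M, -, hM⟩ := hf.exists_norm_le R
  obtain ⟨D, hD, h'⟩ := hg M
  refine ⟨D * C, by positivity, fun x y hx hy => ?_⟩
  refine (h' _ _ (hM x hx) (hM y hy)).trans ?_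
  rw [mul_assoc]
  gcongr
  exact h x y hx hy

lemma bilinear [NormedSpace ℂ F] [NormedSpace ℂ G] [NormedSpace ℂ H] (B : F →L[ℂ] G →L[ℂ] H)
    {f : E → F} {g : E → G} (hf : LipBdd f) (hg : LipBdd g) :
    LipBdd fun x => B (f x) (g x) := by
  intro R
  obtain ⟨C, hC, h⟩ := hf R
  obtain ⟨D, hD, h'⟩ := hg R
  obtain ⟨M, hM0, hM⟩ := hf.exists_norm_le R
  obtain ⟨N, hN0, hN⟩ := hg.exists_norm_le R
  refine ⟨‖B‖ * C * N + ‖B‖ * M * D, by positivity, fun x y hx hy => ?_⟩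
  have e : B (f x) (g x) - B (f y) (g y) = B (f x - f y) (g x) + B (f y) (g x - g y) := by
    simp
  rw [e]
  refine (norm_add_le _ _).trans ?_
  rw [add_mul]
  refine add_le_add ((B.le_opNorm₂ _ _).trans ?_) ((B.le_opNorm₂ _ _).trans ?_)
  · calc ‖B‖ * ‖f x - f y‖ * ‖g x‖ ≤ ‖B‖ * (C * ‖x - y‖) * N := by
          gcongr
          · exact h x y hx hy
          · exact hN x hx
      _ = _ := by ring
  · calc ‖B‖ * ‖f y‖ * ‖g x - g y‖ ≤ ‖B‖ * M * (D * ‖x - y‖) := by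
          gcongr
          · exact hM y hy
          · exact h' x y hx hy
      _ = _ := by ring

lemma continuous {f : E → F} (hf : LipBdd f) : Continuous f := by
  refine continuous_iff_continuousAt.2 fun x => ?_
  obtain ⟨C, hC, h⟩ := hf (‖x‖ + 1)
  refine continuousAt_of_locally_lipschitz zero_lt_one C fun y hy => ?_
  rw [dist_eq_norm, dist_eq_norm]
  rw [dist_eq_norm] at hy
  refine h y x ?_ (by linarith)
  have : ‖y‖ ≤ ‖y - x‖ + ‖x‖ := by simpa using norm_add_le (y - x) x
  linarith

end LipBdd

/-! ### The nonlinearity -/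

lemma product_single_zero (a : Freq → ℂ) : product (Pi.single 0 1) a = a := by
  funext n
  rw [product, tsum_eq_single 0]
  · simp
  · intro m hm
    simp [hm]

/-- The relation between the exponents under which all products are defined. -/
structure Admissible (k : ℕ) (δ θ : ℝ) : Prop where
  two_le : 2 ≤ k
  pos : 0 < θ
  le_mul : θ ≤ 1 / 10 * δ
  le : δ ≤ 1 / (2 * ((k : ℝ) - 1)) + θ / 2

namespace Admissible

variable {k : ℕ} {δ θ : ℝ}

lemma delta_pos (h : Admissible k δ θ) : 0 < δ := by linarith [h.pos, h.le_mul]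

/-- Multiplying the bound on `δ` by `k - 1` gives `(k-1)δ ≤ 1/2 + (k-1)θ/2`. As `θ ≤ δ/10`, the last
term is at most `(k-1)δ/20` and is absorbed on the left. -/
lemma sub_one_mul_le (h : Admissible k δ θ) : ((k : ℝ) - 1) * δ ≤ 10 / 19 := by
  have hk : (2 : ℝ) ≤ k := by exact_mod_cast h.two_le
  have hk1 : 0 < (k : ℝ) - 1 := by linarith
  have h1 := mul_le_mul_of_nonneg_left h.le hk1.le
  have e : ((k : ℝ) - 1) * (1 / (2 * ((k : ℝ) - 1)) + θ / 2) = 1 / 2 + ((k : ℝ) - 1) * θ / 2 := by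
    field_simp
  rw [e] at h1
  have h2 := mul_le_mul_of_nonneg_left h.le_mul hk1.le
  linarith

lemma mul_delta_le (h : Admissible k δ θ) {j : ℕ} (hj : j + 1 < k) :
    ((j : ℝ) + 1) * δ ≤ 10 / 19 := by
  refine le_trans ?_ h.sub_one_mul_le
  have : ((j + 1 + 1 : ℕ) : ℝ) ≤ k := by exact_mod_cast hj
  push_cast at this
  have := h.delta_pos
  gcongr
  linarith

lemma delta_le (h : Admissible k δ θ) : δ ≤ 10 / 19 := by
  simpa using h.mul_delta_le (j := 0) h.two_le

lemma theta_le (h : Admissible k δ θ) : θ ≤ 1 / 19 := by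
  linarith [h.delta_le, h.le_mul]

/-- The regularity of `v ^ (j + 1)` for `v ∈ H^{1-δ}`. -/
lemma exists_power_succ (h : Admissible k δ θ) (j : ℕ) (hj : j + 1 < k) :
    ∃ P : Hs (1 - δ) → Hs (1 - δ - 3 / 2 * j * δ), LipBdd P ∧
      ∀ f, (P f).coeff = power f.coeff (j + 1) := by
  induction j with
  | zero =>
    obtain ⟨I, hI⟩ := Hs.exists_inclusion (s := 1 - δ - 3 / 2 * (0 : ℕ) * δ) (s' := 1 - δ)
      (by simp)
    refine ⟨I, LipBdd.clm I, fun f => ?_⟩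
    rw [hI, zero_add, power, power, product_single_zero]
  | succ j ih =>
    obtain ⟨P, hP, hPc⟩ := ih (by omega)
    have h1 := h.mul_delta_le hj
    have hδ := h.delta_pos
    have hδ' := h.delta_le
    have hj0 : (0 : ℝ) ≤ j * δ := by positivity
    push_cast at h1
    -- A loss of exactly `δ` per factor would give `s₁ + s₂ - s₃ = 1`, which is not allowed; a loss
    -- of `3δ/2` gives `1 + δ/2`.
    obtain ⟨B, hB⟩ := Hs.exists_mul (s₁ := 1 - δ - 3 / 2 * j * δ) (s₂ := 1 - δ)
      (s₃ := 1 - δ - 3 / 2 * (j + 1 : ℕ) * δ) (by nlinarith) (by linarith)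
      (by push_cast; nlinarith) (by push_cast; nlinarith) (by push_cast; nlinarith)
    refine ⟨fun f => B (P f) f, hP.bilinear B (LipBdd.clm (ContinuousLinearMap.id ℂ _)),
      fun f => ?_⟩
    rw [hB, hPc]
    rfl

/-- The right side is at least `1 - (3/2)(j+1)δ ≥ 1 - 15/19 = 4/19`, while `θ ≤ 1/19`. -/
lemma exponent_ge (h : Admissible k δ θ) {j : ℕ} (hj : j + 1 < k) :
    θ ≤ 1 - δ - 3 / 2 * j * δ := by
  have h1 := h.mul_delta_le hj
  have := h.theta_le
  have hδ := h.delta_pos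
  have hj0 : (0 : ℝ) ≤ j * δ := by positivity
  nlinarith

/-- `v ^ j ∈ H^θ` for `v ∈ H^{1-δ}` and `j < k`. -/
lemma exists_power (h : Admissible k δ θ) {j : ℕ} (hj : j < k) :
    ∃ P : Hs (1 - δ) → Hs θ, LipBdd P ∧ ∀ f, (P f).coeff = power f.coeff j := by
  rcases j with _ | j
  · obtain ⟨e, he⟩ := Hs.exists_single θ 0
    exact ⟨fun _ => e, LipBdd.const e, fun _ => he⟩
  · obtain ⟨P, hP, hPc⟩ := h.exists_power_succ j hj
    obtain ⟨I, hI⟩ := Hs.exists_inclusion (h.exponent_ge hj)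
    exact ⟨fun f => I (P f), (LipBdd.clm I).comp hP, fun f => by rw [hI, hPc]⟩

/-- `v ^ k ∈ H^{-δ}` for `v ∈ H^{1-δ}`. -/
lemma exists_power_self (h : Admissible k δ θ) :
    ∃ P : Hs (1 - δ) → Hs (-δ), LipBdd P ∧ ∀ f, (P f).coeff = power f.coeff k := by
  obtain ⟨j, rfl⟩ : ∃ j, k = j + 2 := ⟨k - 2, by have := h.two_le; omega⟩
  obtain ⟨P, hP, hPc⟩ := h.exists_power_succ j (by omega)
  have h1 := h.exponent_ge (j := j) (by omega)
  have hθ := h.pos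
  have hδ := h.delta_le
  have hδ0 := h.delta_pos
  -- The last factor is treated separately because only `H^{-δ}` is needed: here `s₁ + s₂ - s₃ = 1 +
  -- s₁`, and `s₁ ≥ θ > 0`.
  obtain ⟨B, hB⟩ := Hs.exists_mul (s₁ := 1 - δ - 3 / 2 * j * δ) (s₂ := 1 - δ) (s₃ := -δ)
    (by linarith) (by linarith) (by linarith) (by linarith) (by linarith)
  refine ⟨fun f => B (P f) f, hP.bilinear B (LipBdd.clm (ContinuousLinearMap.id ℂ _)),
    fun f => ?_⟩
  rw [hB, hPc]
  rfl

lemma productDefined_power (h : Admissible k δ θ) (f : Hs (1 - δ)) {j : ℕ} (hj : j < k) :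
    ProductDefined (power f.coeff j) f.coeff := by
  obtain ⟨P, -, hPc⟩ := h.exists_power hj
  rw [← hPc]
  exact productDefined_of_summable_sq (Hs.summable_norm_coeff_sq h.pos.le _)
    (f.summable_norm_coeff_sq (by linarith [h.delta_le]))

lemma productDefined_wInf (h : Admissible k δ θ) (f : Hs (1 - δ)) (ξ : WInf (-θ)) {j : ℕ}
    (hj : j < k) : ProductDefined ξ.coeff (power f.coeff j) := by
  obtain ⟨P, -, hPc⟩ := h.exists_power hj
  rw [← hPc]
  exact (WInf.productDefined h.pos.le ξ _).symm

/-- The nonlinearity is a locally Lipschitz map with values in `H^{-δ}`. -/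
lemma exists_nonlinearity (h : Admissible k δ θ) :
    ∃ 𝒩 : (Fin k → WInf (-θ)) × Hs (1 - δ) → Hs (-δ), LipBdd 𝒩 ∧
      ∀ ξ f, (𝒩 (ξ, f)).coeff = nonlinearity (fun j => (ξ j).coeff) f.coeff := by
  obtain ⟨P, hP, hPc⟩ := h.exists_power_self
  have hlt : ∀ j : Fin k, k - ((j : ℕ) + 1) < k := fun j => by have := j.2; omega
  choose Q hQ hQc using fun j : Fin k => h.exists_power (hlt j)
  obtain ⟨B, hB⟩ := WInf.exists_mul h.pos (by linarith [h.theta_le])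
  obtain ⟨I, hI⟩ := Hs.exists_inclusion (s := -δ) (s' := -θ) (by linarith [h.le_mul, h.pos])
  let fstL := ContinuousLinearMap.fst ℂ (Fin k → WInf (-θ)) (Hs (1 - δ))
  let sndL := ContinuousLinearMap.snd ℂ (Fin k → WInf (-θ)) (Hs (1 - δ))
  refine ⟨fun p => P p.2 + ∑ j : Fin k, (k.choose (j + 1) : ℂ) • I (B (p.1 j) (Q j p.2)),
    (hP.comp (LipBdd.clm sndL)).add (LipBdd.sum _ fun j _ => ?_), fun ξ f => ?_⟩
  · have h1 : LipBdd fun p : (Fin k → WInf (-θ)) × Hs (1 - δ) => p.1 j :=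
      LipBdd.clm ((ContinuousLinearMap.proj (R := ℂ) (φ := fun _ : Fin k => WInf (-θ)) j).comp fstL)
    have h2 := h1.bilinear B ((hQ j).comp (LipBdd.clm sndL))
    exact (LipBdd.clm ((k.choose (j + 1) : ℂ) • I)).comp h2
  · funext n
    have hs : ∀ (S : Finset (Fin k)) (g : Fin k → Hs (-δ)),
        (∑ j ∈ S, g j).coeff n = ∑ j ∈ S, (g j).coeff n := fun S g =>
      map_sum (Hs.coeffCLM (-δ) n) g S
    simp only [nonlinearity, Hs.coeff_add, Pi.add_apply, hPc, hs, Hs.coeff_smul, Pi.smul_apply,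
      smul_eq_mul, hI, hB, hQc]

end Admissible

/-! ### The equation for a single Fourier mode -/

/-- `ε² y'' + y' + μ y = f` on `[0,T]`, with `w = y'`; for `ε = 0` no second derivative is needed. -/
structure ModeSol (ε μ T : ℝ) (y w f : ℝ → ℂ) : Prop where
  deriv : ∀ t ∈ Set.Icc 0 T, HasDerivWithinAt y (w t) (Set.Icc 0 T) t
  eq_zero : ε = 0 → ∀ t ∈ Set.Icc 0 T, w t + μ * y t = f t
  eq_pos : 0 < ε → ∀ t ∈ Set.Icc 0 T, ∃ a : ℂ, HasDerivWithinAt w a (Set.Icc 0 T) t ∧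
    (ε : ℂ) ^ 2 * a + w t + μ * y t = f t

namespace ModeSol

variable {ε μ T : ℝ} {y w f y' w' f' : ℝ → ℂ}

lemma sub (h : ModeSol ε μ T y w f) (h' : ModeSol ε μ T y' w' f') :
    ModeSol ε μ T (fun t => y t - y' t) (fun t => w t - w' t) (fun t => f t - f' t) where
  deriv t ht := (h.deriv t ht).sub (h'.deriv t ht)
  eq_zero hε t ht := by
    rw [← h.eq_zero hε t ht, ← h'.eq_zero hε t ht]; ring
  eq_pos hε t ht := by
    obtain ⟨a, ha, e⟩ := h.eq_pos hε t ht
    obtain ⟨a', ha', e'⟩ := h'.eq_pos hε t ht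
    exact ⟨a - a', ha.sub ha', by rw [← e, ← e']; ring⟩

lemma hasDerivWithinAt_integral_sq (hf : Continuous f) (t : ℝ) (s : Set ℝ) :
    HasDerivWithinAt (fun t => ∫ τ in (0 : ℝ)..t, ‖f τ‖ ^ 2) (‖f t‖ ^ 2) s t :=
  (intervalIntegral.integral_hasDerivAt_right ((hf.norm.pow 2).intervalIntegrable _ _)
    ((hf.norm.pow 2).stronglyMeasurableAtFilter _ _) (hf.norm.pow 2).continuousAt).hasDerivWithinAt

/-- The energy inequality, uniform in `ε`. -/
lemma energy (h : ModeSol ε μ T y w f) (hε : 0 ≤ ε) (hf : Continuous f) {t : ℝ}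
    (ht : t ∈ Set.Icc 0 T) :
    μ * ‖y t‖ ^ 2 ≤ μ * ‖y 0‖ ^ 2 + ε ^ 2 * ‖w 0‖ ^ 2 + 1 / 2 * ∫ τ in (0 : ℝ)..t, ‖f τ‖ ^ 2 := by
  have h0 : (0 : ℝ) ∈ Set.Icc 0 T := ⟨le_rfl, ht.1.trans ht.2⟩
  -- With `p = y'` and `q = ε² y'' + μ y`, the energy has derivative `2⟨p, q⟩` and the force is `p +
  -- q`, so energy minus half the integral of `|f|²` is nonincreasing.
  have alg : ∀ p q : ℂ, 2 * inner ℝ p q - 1 / 2 * ‖p + q‖ ^ 2 = -(1 / 2) * ‖p - q‖ ^ 2 := by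
    intro p q
    rw [norm_add_sq_real, norm_sub_sq_real]; ring
  rcases hε.eq_or_lt with rfl | hε
  · have hd : ∀ t ∈ Set.Icc 0 T, HasDerivWithinAt
        (fun t => μ * ‖y t‖ ^ 2 - 1 / 2 * ∫ τ in (0 : ℝ)..t, ‖f τ‖ ^ 2)
        (μ * (2 * inner ℝ (y t) (w t)) - 1 / 2 * ‖f t‖ ^ 2) (Set.Icc 0 T) t := fun t ht =>
      ((h.deriv t ht).norm_sq.const_mul μ).sub
        ((hasDerivWithinAt_integral_sq hf t _).const_mul (1 / 2))
    have hanti := antitoneOn_of_hasDerivWithinAt_nonpos (convex_Icc 0 T)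
      (fun t ht => (hd t ht).continuousWithinAt)
      (fun t ht => (hd t (interior_subset ht)).mono interior_subset) (fun t ht => by
        have e := h.eq_zero rfl t (interior_subset ht)
        have := alg (w t) (μ * y t)
        rw [e] at this
        have e2 : inner ℝ (w t) ((μ : ℂ) * y t) = μ * inner ℝ (y t) (w t) := by
          rw [real_inner_comm, ← Complex.real_smul, real_inner_smul_left]
        rw [e2] at this
        nlinarith [sq_nonneg ‖w t - μ * y t‖])
    have := hanti h0 ht ht.1
    simp only [intervalIntegral.integral_same] at this
    nlinarith
  · choose! a ha hae using h.eq_pos hε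
    have hd : ∀ t ∈ Set.Icc 0 T, HasDerivWithinAt
        (fun t => μ * ‖y t‖ ^ 2 + ε ^ 2 * ‖w t‖ ^ 2 - 1 / 2 * ∫ τ in (0 : ℝ)..t, ‖f τ‖ ^ 2)
        (μ * (2 * inner ℝ (y t) (w t)) + ε ^ 2 * (2 * inner ℝ (w t) (a t)) - 1 / 2 * ‖f t‖ ^ 2)
        (Set.Icc 0 T) t := fun t ht =>
      (((h.deriv t ht).norm_sq.const_mul μ).add ((ha t ht).norm_sq.const_mul (ε ^ 2))).sub
        ((hasDerivWithinAt_integral_sq hf t _).const_mul (1 / 2))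
    have hanti := antitoneOn_of_hasDerivWithinAt_nonpos (convex_Icc 0 T)
      (fun t ht => (hd t ht).continuousWithinAt)
      (fun t ht => (hd t (interior_subset ht)).mono interior_subset) (fun t ht => by
        have e := hae t (interior_subset ht)
        have := alg (w t) ((ε : ℂ) ^ 2 * a t + μ * y t)
        rw [show w t + ((ε : ℂ) ^ 2 * a t + μ * y t) = f t by rw [← e]; ring] at this
        have e2 : inner ℝ (w t) ((ε : ℂ) ^ 2 * a t + μ * y t) =
            ε ^ 2 * inner ℝ (w t) (a t) + μ * inner ℝ (y t) (w t) := by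
          rw [inner_add_right, ← Complex.ofReal_pow, ← Complex.real_smul, ← Complex.real_smul,
            real_inner_smul_right, real_inner_smul_right, real_inner_comm (w t) (y t)]
        rw [e2] at this
        nlinarith [sq_nonneg ‖w t - ((ε : ℂ) ^ 2 * a t + μ * y t)‖])
    have := hanti h0 ht ht.1
    simp only [intervalIntegral.integral_same] at this
    nlinarith [mul_nonneg (sq_nonneg ε) (sq_nonneg ‖w t‖)]

end ModeSol

/-! ### Existence for a single mode -/

lemma exists_first_order (r c : ℂ) {f : ℝ → ℂ} (hf : Continuous f) :
    ∃ y : ℝ → ℂ, (∀ t, HasDerivAt y (r * y t + f t) t) ∧ y 0 = c := by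
  refine ⟨fun t => Complex.exp (r * t) * (c + ∫ τ in (0 : ℝ)..t, Complex.exp (-(r * τ)) * f τ),
    fun t => ?_, by simp⟩
  have hg : Continuous fun τ : ℝ => Complex.exp (-(r * τ)) * f τ := by fun_prop
  have h1 : HasDerivAt (fun t : ℝ => Complex.exp (r * t)) (Complex.exp (r * t) * (r * 1)) t :=
    ((Complex.ofRealCLM.hasDerivAt (x := t)).const_mul r).cexp
  have h2 : HasDerivAt (fun t : ℝ => c + ∫ τ in (0 : ℝ)..t, Complex.exp (-(r * τ)) * f τ)
      (Complex.exp (-(r * t)) * f t) t :=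
    (intervalIntegral.integral_hasDerivAt_right (hg.intervalIntegrable _ _)
      (hg.stronglyMeasurableAtFilter _ _) hg.continuousAt).const_add c
  refine (h1.mul h2).congr_deriv ?_
  have : Complex.exp (r * t) * Complex.exp (-(r * t)) = 1 := by
    rw [← Complex.exp_add, add_neg_cancel, Complex.exp_zero]
  linear_combination f t * this

/-- The operator factors as `ε² (∂ - r₁)(∂ - r₂)` with complex roots: solve for `x = y' - r₁ y`
first, then for `y`. A double root needs no separate treatment. -/
lemma exists_second_order {ε : ℝ} (hε : 0 < ε) (μ : ℝ) (a b : ℂ) {f : ℝ → ℂ} (hf : Continuous f) :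
    ∃ y w z : ℝ → ℂ, (∀ t, HasDerivAt y (w t) t) ∧ (∀ t, HasDerivAt w (z t) t) ∧ Continuous z ∧
      (∀ t, (ε : ℂ) ^ 2 * z t + w t + μ * y t = f t) ∧ y 0 = a ∧ w 0 = b := by
  have hε' : (ε : ℂ) ≠ 0 := by exact_mod_cast hε.ne'
  obtain ⟨d, hd⟩ := IsAlgClosed.exists_eq_mul_self (1 - 4 * (ε : ℂ) ^ 2 * μ)
  set r₁ : ℂ := (-1 + d) / (2 * (ε : ℂ) ^ 2) with hr₁
  set r₂ : ℂ := (-1 - d) / (2 * (ε : ℂ) ^ 2) with hr₂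
  have hsum : (ε : ℂ) ^ 2 * (r₁ + r₂) = -1 := by rw [hr₁, hr₂]; field_simp; ring
  have hprod : (ε : ℂ) ^ 2 * (r₁ * r₂) = μ := by
    rw [hr₁, hr₂]; field_simp; linear_combination hd
  obtain ⟨x, hx, hx0⟩ := exists_first_order r₂ (b - r₁ * a) (f := fun t => f t / (ε : ℂ) ^ 2)
    (by fun_prop)
  have hxc : Continuous x := continuous_iff_continuousAt.2 fun t => (hx t).continuousAt
  obtain ⟨y, hy, hy0⟩ := exists_first_order r₁ a hxc
  have hyc : Continuous y := continuous_iff_continuousAt.2 fun t => (hy t).continuousAt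
  refine ⟨y, fun t => r₁ * y t + x t,
    fun t => r₁ * (r₁ * y t + x t) + (r₂ * x t + f t / (ε : ℂ) ^ 2), hy,
    fun t => ((hy t).const_mul r₁).add (hx t), by fun_prop, fun t => ?_, hy0, ?_⟩
  · have : (ε : ℂ) ^ 2 * (f t / (ε : ℂ) ^ 2) = f t := by field_simp
    linear_combination this + (r₁ * y t + x t) * hsum - y t * hprod
  · beta_reduce; rw [hy0, hx0]; ring

lemma exists_modeSol {ε : ℝ} (hε : 0 ≤ ε) (μ T : ℝ) (a b : ℂ) {f : ℝ → ℂ} (hf : Continuous f) :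
    ∃ y w : ℝ → ℂ, ModeSol ε μ T y w f ∧ y 0 = a ∧ (0 < ε → w 0 = b) := by
  rcases hε.eq_or_lt with rfl | hε
  · obtain ⟨y, hy, hy0⟩ := exists_first_order (-μ) a hf
    refine ⟨y, fun t => -μ * y t + f t, ⟨fun t _ => (hy t).hasDerivWithinAt, fun _ t _ => by ring,
      fun h => (lt_irrefl _ h).elim⟩, hy0, fun h => (lt_irrefl _ h).elim⟩
  · obtain ⟨y, w, z, hy, hw, -, he, hy0, hw0⟩ := exists_second_order hε μ a b hf
    exact ⟨y, w, ⟨fun t _ => (hy t).hasDerivWithinAt, fun h => (hε.ne' h).elim,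
      fun _ t _ => ⟨z t, (hw t).hasDerivWithinAt, he t⟩⟩, hy0, fun _ => hw0⟩

/-- For a continuously differentiable force the solution is twice continuously differentiable, also
for `ε = 0`. -/
lemma exists_classical_mode {ε : ℝ} (hε : 0 ≤ ε) (μ : ℝ) (a b : ℂ) {f f' : ℝ → ℂ}
    (hf : ∀ t, HasDerivAt f (f' t) t) (hf' : Continuous f') :
    ∃ y w z : ℝ → ℂ, (∀ t, HasDerivAt y (w t) t) ∧ (∀ t, HasDerivAt w (z t) t) ∧ Continuous z ∧
      (∀ t, (ε : ℂ) ^ 2 * z t + w t + μ * y t = f t) ∧ y 0 = a ∧ (0 < ε → w 0 = b) := by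
  have hfc : Continuous f := continuous_iff_continuousAt.2 fun t => (hf t).continuousAt
  rcases hε.eq_or_lt with rfl | hε
  · obtain ⟨y, hy, hy0⟩ := exists_first_order (-μ) a hfc
    have hyc : Continuous y := continuous_iff_continuousAt.2 fun t => (hy t).continuousAt
    refine ⟨y, fun t => -μ * y t + f t, fun t => -μ * (-μ * y t + f t) + f' t, hy,
      fun t => ((hy t).const_mul _).add (hf t), by fun_prop, fun t => ?_, hy0,
      fun h => (lt_irrefl _ h).elim⟩
    simp
  · obtain ⟨y, w, z, hy, hw, hz, he, hy0, hw0⟩ := exists_second_order hε μ a b hfc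
    exact ⟨y, w, z, hy, hw, hz, he, hy0, fun _ => hw0⟩

lemma exists_polynomial_approx {T : ℝ} {f : ℝ → ℂ} (hf : Continuous f) {η : ℝ} (hη : 0 < η) :
    ∃ p p' : ℝ → ℂ, (∀ t, HasDerivAt p (p' t) t) ∧ Continuous p' ∧
      ∀ t ∈ Set.Icc 0 T, ‖f t - p t‖ ≤ η := by
  obtain ⟨P, hP⟩ := exists_polynomial_near_of_continuousOn 0 T (fun t => (f t).re)
    (Complex.continuous_re.comp hf).continuousOn (η / 2) (by positivity)
  obtain ⟨Q, hQ⟩ := exists_polynomial_near_of_continuousOn 0 T (fun t => (f t).im)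
    (Complex.continuous_im.comp hf).continuousOn (η / 2) (by positivity)
  refine ⟨fun t => ((P.eval t : ℝ) : ℂ) + ((Q.eval t : ℝ) : ℂ) * Complex.I,
    fun t => ((P.derivative.eval t : ℝ) : ℂ) + ((Q.derivative.eval t : ℝ) : ℂ) * Complex.I,
    fun t => (P.hasDerivAt t).ofReal_comp.add ((Q.hasDerivAt t).ofReal_comp.mul_const _), ?_,
    fun t ht => ?_⟩
  · have h1 := P.derivative.continuous
    have h2 := Q.derivative.continuous
    fun_prop
  · have h1 := (hP t ht).le
    have h2 := (hQ t ht).le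
    rw [abs_sub_comm] at h1 h2
    refine (Complex.norm_le_abs_re_add_abs_im _).trans ?_
    simp only [Complex.sub_re, Complex.add_re, Complex.mul_re, Complex.sub_im, Complex.add_im,
      Complex.mul_im, Complex.ofReal_re, Complex.ofReal_im, Complex.I_re, Complex.I_im]
    ring_nf at h1 h2 ⊢
    linarith

/-! ### Joint continuity of a mode in `(ε, t)` -/

/-- At `ε₀ = 0` the limit need not have a second derivative. The force at `ε₀` is therefore
approximated by a polynomial in time, whose solution `q` at `ε₀` is `C²`. Then `q` nearly solves the
equation for `ε` near `ε₀`, and the energy inequality bounds `y ε - q` uniformly in time. -/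
lemma continuous_mode {T μ : ℝ} (hT : 0 ≤ T) (hT1 : T ≤ 1) (hμ : 0 < μ)
    (F : C(Set.Icc (0 : ℝ) 1 × Set.Icc (0 : ℝ) T, ℂ)) {y w : Set.Icc (0 : ℝ) 1 → ℝ → ℂ} {a b : ℂ}
    (h : ∀ ε : Set.Icc (0 : ℝ) 1, ModeSol ε μ T (y ε) (w ε) fun t => F (ε, Set.projIcc 0 T hT t))
    (hy : ∀ ε, y ε 0 = a) (hw : ∀ ε : Set.Icc (0 : ℝ) 1, 0 < (ε : ℝ) → w ε 0 = b) :
    Continuous fun p : Set.Icc (0 : ℝ) 1 × Set.Icc (0 : ℝ) T => y p.1 p.2 := by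
  refine continuous_iff_continuousAt.2 fun ⟨ε₀, t₀⟩ => ?_
  refine continuousAt_of_locally_uniform_approx_of_continuousAt fun U hU => ?_
  obtain ⟨η, hη, hηU⟩ := Metric.mem_uniformity_dist.1 hU
  have hFc : ∀ ε, Continuous fun t => F (ε, Set.projIcc 0 T hT t) := fun ε => by
    have := continuous_projIcc (a := (0 : ℝ)) (b := T) (h := hT)
    fun_prop
  -- The approximation error enters the energy as `ρ²/2 = μη²/2`, strictly below the target `μη²`.
  set ρ := Real.sqrt μ * η with hρ
  have hρ0 : 0 < ρ := by positivity
  have hρsq : ρ ^ 2 = μ * η ^ 2 := by rw [hρ, mul_pow, Real.sq_sqrt hμ.le]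
  obtain ⟨p, p', hp, hp', hpF⟩ := exists_polynomial_approx (T := T) (hFc ε₀) hρ0
  obtain ⟨q, x, z, hq, hx, hz, he, hq0, hx0⟩ :=
    exists_classical_mode ε₀.2.1 μ a b hp hp'
  have hqc : Continuous q := continuous_iff_continuousAt.2 fun t => (hq t).continuousAt
  have hpc : Continuous p := continuous_iff_continuousAt.2 fun t => (hp t).continuousAt
  obtain ⟨M, hM⟩ := isCompact_Icc.exists_bound_of_continuousOn (s := Set.Icc 0 T) hz.continuousOn
  set β := ‖b - x 0‖ ^ 2
  set κ : Set.Icc (0 : ℝ) 1 → ℝ := fun ε => |(ε : ℝ) ^ 2 - (ε₀ : ℝ) ^ 2| with hκ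
  set σ : Set.Icc (0 : ℝ) 1 → ℝ := fun ε => dist (F.curry ε) (F.curry ε₀) with hσ
  have hclose : ∀ᶠ ε in 𝓝 ε₀, κ ε * β + 1 / 2 * (σ ε + ρ + κ ε * M) ^ 2 < μ * η ^ 2 := by
    have hcont : Continuous fun ε => κ ε * β + 1 / 2 * (σ ε + ρ + κ ε * M) ^ 2 := by
      have : Continuous κ := by fun_prop
      have : Continuous σ := F.curry.continuous.dist continuous_const
      fun_prop
    refine hcont.continuousAt.eventually_lt continuousAt_const ?_
    simp only [hκ, hσ, sub_self, abs_zero, dist_self, zero_mul, zero_add, add_zero, hρsq]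
    nlinarith [mul_pos hμ (pow_pos hη 2)]
  refine ⟨{ε | κ ε * β + 1 / 2 * (σ ε + ρ + κ ε * M) ^ 2 < μ * η ^ 2} ×ˢ Set.univ,
    prod_mem_nhds hclose univ_mem, fun p => q p.2, by fun_prop, ?_⟩
  rintro ⟨ε, t⟩ ⟨hε, -⟩
  refine hηU ?_
  simp only [Set.mem_ofPred_eq] at hε
  -- This is the force for which `q` solves the equation with parameter `ε`: only the coefficient of
  -- `q'' = z` has changed.
  set f : ℝ → ℂ := fun t => p t + ((ε : ℂ) ^ 2 - (ε₀ : ℂ) ^ 2) * z t with hf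
  have hfc : Continuous f := by fun_prop
  have hmode : ModeSol ε μ T q x f := by
    refine ⟨fun t _ => (hq t).hasDerivWithinAt, fun h0 t _ => ?_,
      fun _ t _ => ⟨z t, (hx t).hasDerivWithinAt, ?_⟩⟩
    · simp only [hf, ← he t, h0]
      push_cast
      ring
    · simp only [hf, ← he t]
      ring
  have hen := ((h ε).sub hmode).energy ε.2.1 ((hFc ε).sub hfc) t.2
  rw [hy, hq0, sub_self, norm_zero] at hen
  -- If both parameters are positive the initial velocities agree. At `ε₀ = 0` they may differ (the
  -- initial layer), but then the weight `ε²` equals `κ ε` and is small.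
  have h1 : (ε : ℝ) ^ 2 * ‖w ε 0 - x 0‖ ^ 2 ≤ κ ε * β := by
    rcases ε.2.1.eq_or_lt with h0 | h0
    · rw [← h0]
      have : 0 ≤ κ ε * β := by positivity
      simpa using this
    · rw [hw ε h0]
      rcases ε₀.2.1.eq_or_lt with h2 | h2
      · simp only [hκ, ← h2]
        rw [zero_pow two_ne_zero, sub_zero, abs_of_nonneg (sq_nonneg _)]
      · rw [hx0 h2, sub_self, norm_zero]
        simp only [ne_eq, OfNat.ofNat_ne_zero, not_false_eq_true, zero_pow, mul_zero]
        positivity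
  have hbound : ∀ τ ∈ Set.Icc 0 T, ‖F (ε, Set.projIcc 0 T hT τ) - f τ‖ ≤ σ ε + ρ + κ ε * M := by
    intro τ hτ
    have e : F (ε, Set.projIcc 0 T hT τ) - f τ =
        (F (ε, Set.projIcc 0 T hT τ) - F (ε₀, Set.projIcc 0 T hT τ)) +
        (F (ε₀, Set.projIcc 0 T hT τ) - p τ) - ((ε : ℂ) ^ 2 - (ε₀ : ℂ) ^ 2) * z τ := by
      simp only [hf]; ring
    rw [e]
    refine (norm_sub_le _ _).trans (add_le_add ((norm_add_le _ _).trans (add_le_add ?_ ?_)) ?_)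
    · rw [← dist_eq_norm]
      exact ContinuousMap.dist_apply_le_dist (f := F.curry ε) (g := F.curry ε₀) _
    · exact hpF τ hτ
    · rw [norm_mul]
      have : ‖(ε : ℂ) ^ 2 - (ε₀ : ℂ) ^ 2‖ = κ ε := by
        rw [hκ, ← Complex.ofReal_pow, ← Complex.ofReal_pow, ← Complex.ofReal_sub,
          Complex.norm_real, Real.norm_eq_abs]
      rw [this]
      gcongr
      exact hM τ hτ
  have h2 : ∫ τ in (0 : ℝ)..t, ‖F (ε, Set.projIcc 0 T hT τ) - f τ‖ ^ 2 ≤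
      (σ ε + ρ + κ ε * M) ^ 2 := by
    calc _ ≤ ∫ τ in (0 : ℝ)..t, (σ ε + ρ + κ ε * M) ^ 2 := by
          refine intervalIntegral.integral_mono_on t.2.1
            ((((hFc ε).sub hfc).norm.pow 2).intervalIntegrable _ _)
            (continuous_const.intervalIntegrable _ _) fun τ hτ => ?_
          exact pow_le_pow_left₀ (norm_nonneg _) (hbound τ ⟨hτ.1, hτ.2.trans t.2.2⟩) 2
      _ = t * (σ ε + ρ + κ ε * M) ^ 2 := by simp
      _ ≤ _ := mul_le_of_le_one_left (sq_nonneg _) (t.2.2.trans hT1)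
  have h3 : μ * ‖y ε t - q t‖ ^ 2 < μ * η ^ 2 := by
    refine hen.trans_lt (lt_of_le_of_lt ?_ hε)
    linarith
  rw [dist_eq_norm]
  exact lt_of_pow_lt_pow_left₀ 2 hη.le (lt_of_mul_lt_mul_left h3 hμ.le)

/-! ### The linear equation in `H^s` -/

/-- `ε² u'' + u' + (1 - Δ) u = F` on `[0,T]`, with `w = u'`, mode by mode. -/
def LinSol (ε T : ℝ) (u w F : ℝ → Freq → ℂ) : Prop :=
  ∀ n, ModeSol ε (bracket n ^ 2) T (fun t => u t n) (fun t => w t n) fun t => F t n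

lemma LinSol.sub {ε T : ℝ} {u w F u' w' F' : ℝ → Freq → ℂ} (h : LinSol ε T u w F)
    (h' : LinSol ε T u' w' F') :
    LinSol ε T (fun t => u t - u' t) (fun t => w t - w' t) fun t => F t - F' t :=
  fun n => (h n).sub (h' n)

lemma partialSq_add_one (r : ℝ) (a : Freq → ℂ) (S : Finset Freq) :
    partialSq (r + 1) a S = ∑ n ∈ S, (bracket n ^ r) ^ 2 * (bracket n ^ 2 * ‖a n‖ ^ 2) := by
  refine Finset.sum_congr rfl fun n _ => ?_
  rw [Real.rpow_add_one (bracket_pos n).ne']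
  ring

lemma partialSq_eq_sum (r : ℝ) (a : Freq → ℂ) (S : Finset Freq) :
    partialSq r a S = ∑ n ∈ S, (bracket n ^ r) ^ 2 * ‖a n‖ ^ 2 :=
  Finset.sum_congr rfl fun _ _ => mul_pow _ _ _

lemma continuous_partialSq {X : Type*} [TopologicalSpace X] {r : ℝ} {G : X → Hs r}
    (hG : Continuous G) (S : Finset Freq) : Continuous fun x => partialSq r (G x).coeff S := by
  refine continuous_finsetSum _ fun n _ => ?_
  have : Continuous fun x => (G x).coeff n := (Hs.coeffCLM r n).continuous.comp hG
  fun_prop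

/-- The factor `μ = ⟨n⟩²` in the mode energy is the gain of one derivative. Keeping an arbitrary
finite `S` lets the estimate serve for tails as well as for norms. -/
lemma LinSol.partialSq_le {ε T r : ℝ} {u w F : ℝ → Freq → ℂ} (h : LinSol ε T u w F) (hε : 0 ≤ ε)
    {G : ℝ → Hs r} (hG : Continuous G) (hGF : ∀ t, F t = (G t).coeff) (S : Finset Freq) {t : ℝ}
    (ht : t ∈ Set.Icc 0 T) :
    partialSq (r + 1) (u t) S ≤ partialSq (r + 1) (u 0) S + ε ^ 2 * partialSq r (w 0) S +
      1 / 2 * ∫ τ in (0 : ℝ)..t, partialSq r (G τ).coeff S := by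
  have hF : ∀ n, Continuous fun t => F t n := fun n => by
    simp only [hGF]
    exact (Hs.coeffCLM r n).continuous.comp hG
  have hint : ∫ τ in (0 : ℝ)..t, partialSq r (G τ).coeff S =
      ∑ n ∈ S, (bracket n ^ r) ^ 2 * ∫ τ in (0 : ℝ)..t, ‖F τ n‖ ^ 2 := by
    simp only [partialSq_eq_sum, hGF]
    simp only [hGF] at hF
    have hi : ∀ n ∈ S, IntervalIntegrable
        (fun τ => (bracket n ^ r) ^ 2 * ‖(G τ).coeff n‖ ^ 2) volume 0 t := fun n _ =>
      (continuous_const.mul ((hF n).norm.pow 2)).intervalIntegrable _ _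
    rw [intervalIntegral.integral_finsetSum hi]
    simp only [intervalIntegral.integral_const_mul]
  rw [hint, partialSq_add_one, partialSq_add_one, partialSq_eq_sum, Finset.mul_sum, Finset.mul_sum,
    ← Finset.sum_add_distrib, ← Finset.sum_add_distrib]
  refine Finset.sum_le_sum fun n _ => ?_
  have := mul_le_mul_of_nonneg_left ((h n).energy hε (hF n) ht) (sq_nonneg (bracket n ^ r))
  linarith

/-- The energy estimate, uniform in `ε ∈ [0,1]`. -/
lemma LinSol.norm_sq_le {ε T r s₀ s₁ : ℝ} {w F : ℝ → Freq → ℂ} {V : ℝ → Hs (r + 1)}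
    (h : LinSol ε T (fun t => (V t).coeff) w F) (hε : ε ∈ Set.Icc (0 : ℝ) 1) {φ₀ : Hs s₀}
    {φ₁ : Hs s₁} (hs₀ : r + 1 ≤ s₀) (hs₁ : r ≤ s₁) (h₀ : (V 0).coeff = φ₀.coeff)
    (h₁ : 0 < ε → w 0 = φ₁.coeff) {G : ℝ → Hs r} (hG : Continuous G)
    (hGF : ∀ t, F t = (G t).coeff) {t : ℝ} (ht : t ∈ Set.Icc 0 T) :
    ‖V t‖ ^ 2 ≤ ‖φ₀‖ ^ 2 + ‖φ₁‖ ^ 2 + 1 / 2 * ∫ τ in (0 : ℝ)..t, ‖G τ‖ ^ 2 := by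
  refine Hs.norm_sq_le_of_partialSq_le fun S => ?_
  refine (h.partialSq_le hε.1 hG hGF S ht).trans ?_
  have a₀ : partialSq (r + 1) (V 0).coeff S ≤ ‖φ₀‖ ^ 2 := by
    rw [h₀]; exact (partialSq_anti hs₀ _ _).trans (φ₀.partialSq_le S)
  have a₁ : ε ^ 2 * partialSq r (w 0) S ≤ ‖φ₁‖ ^ 2 := by
    rcases hε.1.eq_or_lt with h0 | h0
    · rw [← h0]; simp
    · rw [h₁ h0]
      have : partialSq r φ₁.coeff S ≤ ‖φ₁‖ ^ 2 :=
        (partialSq_anti hs₁ _ _).trans (φ₁.partialSq_le S)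
      have h2 : ε ^ 2 ≤ 1 := pow_le_one₀ hε.1 hε.2
      nlinarith [partialSq_nonneg r φ₁.coeff S]
  have a₂ : ∫ τ in (0 : ℝ)..t, partialSq r (G τ).coeff S ≤ ∫ τ in (0 : ℝ)..t, ‖G τ‖ ^ 2 :=
    intervalIntegral.integral_mono_on ht.1 ((continuous_partialSq hG S).intervalIntegrable _ _)
      ((hG.norm.pow 2).intervalIntegrable _ _) fun τ _ => (G τ).partialSq_le S
  linarith

/-! ### Fourier tails and solvability of the linear equation. -/

lemma Hs.hasSum_norm_sq {s : ℝ} (f : Hs s) :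
    HasSum (fun n => (bracket n ^ s * ‖f.coeff n‖) ^ 2) (‖f‖ ^ 2) := by
  have h := lp.hasSum_norm (p := 2) (by simp) (toL2 s f)
  simp only [ENNReal.toReal_ofNat, Real.rpow_two, norm_toL2_apply] at h
  exact h

lemma Hs.tendsto_partialSq {s : ℝ} (f : Hs s) :
    Tendsto (fun S => ‖f‖ ^ 2 - partialSq s f.coeff S) atTop (𝓝 0) := by
  have h := (tendsto_const_nhds (x := ‖f‖ ^ 2)).sub f.hasSum_norm_sq
  rw [sub_self] at h
  exact h

lemma Hs.partialSq_sdiff_le {s : ℝ} (f : Hs s) (S S' : Finset Freq) :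
    partialSq s f.coeff (S' \ S) ≤ ‖f‖ ^ 2 - partialSq s f.coeff S := by
  have h := f.partialSq_le (S' ∪ S)
  rw [partialSq, ← Finset.sdiff_union_self_eq_union,
    Finset.sum_union Finset.sdiff_disjoint] at h
  simp only [partialSq] at h ⊢
  linarith

/-- The tails of a continuous family over a compact space are uniformly small. -/
lemma tendstoUniformly_tail {X : Type*} [TopologicalSpace X] [CompactSpace X] {r : ℝ} {G : X → Hs r}
    (hG : Continuous G) :
    TendstoUniformly (fun S x => ‖G x‖ ^ 2 - partialSq r (G x).coeff S) (fun _ => 0)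
      (atTop : Filter (Finset Freq)) := by
  -- Dini's theorem: the tails are continuous, decrease in `S`, and tend to zero pointwise on a
  -- compact space.
  refine Antitone.tendstoUniformly_of_forall_tendsto
    (fun S => (hG.norm.pow 2).sub (continuous_partialSq hG S)) (fun S S' h x => ?_)
    continuous_const (fun x => (G x).tendsto_partialSq)
  exact sub_le_sub_left
    (Finset.sum_le_sum_of_subset_of_nonneg h fun _ _ _ => sq_nonneg _) _

/-- Solvability of the linear equation in `C([0,1] × [0,T]; H^{r+1})` with a force in
`C([0,1] × [0,T]; H^r)`. -/
lemma exists_linSol {r T : ℝ} (hT : 0 ≤ T) (hT1 : T ≤ 1) (φ₀ : Hs (r + 1)) (φ₁ : Hs r)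
    (G : C(Set.Icc (0 : ℝ) 1 × Set.Icc (0 : ℝ) T, Hs r)) :
    ∃ v : C(Set.Icc (0 : ℝ) 1 × Set.Icc (0 : ℝ) T, Hs (r + 1)),
      ∀ ε : Set.Icc (0 : ℝ) 1, ∃ w : ℝ → Freq → ℂ,
        LinSol ε T (fun t => (v (ε, Set.projIcc 0 T hT t)).coeff) w
          (fun t => (G (ε, Set.projIcc 0 T hT t)).coeff) ∧
        (v (ε, Set.projIcc 0 T hT 0)).coeff = φ₀.coeff ∧ (0 < (ε : ℝ) → w 0 = φ₁.coeff) := by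
  have hGc : ∀ ε, Continuous fun t => G (ε, Set.projIcc 0 T hT t) := fun ε => by
    have := continuous_projIcc (a := (0 : ℝ)) (b := T) (h := hT)
    fun_prop
  choose y w hy hy0 hw0 using fun (ε : Set.Icc (0 : ℝ) 1) (n : Freq) =>
    exists_modeSol ε.2.1 (bracket n ^ 2) T (φ₀.coeff n) (φ₁.coeff n)
      ((Hs.coeffCLM r n).continuous.comp (hGc ε))
  have hlin : ∀ ε : Set.Icc (0 : ℝ) 1, LinSol ε T (fun t n => y ε n t) (fun t n => w ε n t)
      fun t => (G (ε, Set.projIcc 0 T hT t)).coeff := fun ε n => hy ε n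
  have hest : ∀ (ε : Set.Icc (0 : ℝ) 1) (t : Set.Icc (0 : ℝ) T) (S : Finset Freq) (M : ℝ),
      (∀ p, partialSq r (G p).coeff S ≤ M) →
      partialSq (r + 1) (fun n => y ε n t) S ≤
        partialSq (r + 1) φ₀.coeff S + partialSq r φ₁.coeff S + M := by
    intro ε t S M hM
    refine ((hlin ε).partialSq_le ε.2.1 (hGc ε) (fun _ => rfl) S t.2).trans ?_
    have hM0 : 0 ≤ M := (partialSq_nonneg _ _ _).trans (hM (ε, t))
    have a₀ : (fun n => y ε n 0) = φ₀.coeff := funext fun n => hy0 ε n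
    have a₁ : (ε : ℝ) ^ 2 * partialSq r (fun n => w ε n 0) S ≤ partialSq r φ₁.coeff S := by
      rcases ε.2.1.eq_or_lt with h0 | h0
      · rw [← h0]; simp [partialSq_nonneg]
      · rw [show (fun n => w ε n 0) = φ₁.coeff from funext fun n => hw0 ε n h0]
        exact mul_le_of_le_one_left (partialSq_nonneg _ _ _) (pow_le_one₀ ε.2.1 ε.2.2)
    have a₂ : ∫ τ in (0 : ℝ)..t, partialSq r (G (ε, Set.projIcc 0 T hT τ)).coeff S ≤ M := by
      calc _ ≤ ∫ τ in (0 : ℝ)..t, M :=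
            intervalIntegral.integral_mono_on t.2.1
              ((continuous_partialSq (hGc ε) S).intervalIntegrable _ _)
              (continuous_const.intervalIntegrable _ _) fun τ _ => hM _
        _ = t * M := by simp
        _ ≤ M := mul_le_of_le_one_left hM0 (t.2.2.trans hT1)
    rw [a₀]
    linarith
  have hmem : ∀ p : Set.Icc (0 : ℝ) 1 × Set.Icc (0 : ℝ) T,
      ∃ f : Hs (r + 1), f.coeff = fun n => y p.1 n p.2 := fun p =>
    Hs.exists_of_partialSq_le (C := ‖φ₀‖ ^ 2 + ‖φ₁‖ ^ 2 + ‖G‖ ^ 2) fun S => by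
      refine (hest p.1 p.2 S (‖G‖ ^ 2) fun q => ((G q).partialSq_le S).trans ?_).trans ?_
      · exact pow_le_pow_left₀ (norm_nonneg _) (G.norm_coe_le_norm q) 2
      · linarith [φ₀.partialSq_le S, φ₁.partialSq_le S]
  choose V hV using hmem
  choose e he using Hs.exists_single (r + 1)
  have hmode : ∀ n, Continuous fun p : Set.Icc (0 : ℝ) 1 × Set.Icc (0 : ℝ) T => y p.1 n p.2 :=
    fun n => continuous_mode hT hT1 (pow_pos (bracket_pos n) 2)
      ⟨fun p => (G p).coeff n, (Hs.coeffCLM r n).continuous.comp G.continuous⟩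
      (fun ε => hy ε n) (fun ε => hy0 ε n) (fun ε => hw0 ε n)
  -- The truncations `VS` are continuous mode by mode. They converge uniformly because `hest` on `S'
  -- \ S` bounds the tail of the solution by the tails of the data and the force.
  have hVcont : Continuous V := by
    set VS : Finset Freq → Set.Icc (0 : ℝ) 1 × Set.Icc (0 : ℝ) T → Hs (r + 1) :=
      fun S p => ∑ n ∈ S, y p.1 n p.2 • e n with hVS
    have hVScont : ∀ S, Continuous (VS S) := fun S =>
      continuous_finsetSum _ fun n _ => (hmode n).smul continuous_const
    have hVSc : ∀ S p m, (VS S p).coeff m = if m ∈ S then y p.1 m p.2 else 0 := by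
      intro S p m
      have h1 : (VS S p).coeff m = ∑ n ∈ S, (y p.1 n p.2 • e n).coeff m :=
        map_sum (Hs.coeffCLM (r + 1) m) _ S
      rw [h1]
      simp only [Hs.coeff_smul, he, Pi.smul_apply, smul_eq_mul, Pi.single_apply, mul_ite, mul_one,
        mul_zero, Finset.sum_ite_eq]
    refine TendstoUniformly.continuous (F := VS) (p := atTop) ?_
      (Eventually.frequently (Eventually.of_forall hVScont))
    rw [Metric.tendstoUniformly_iff]
    intro η hη
    have hη2 : 0 < η ^ 2 / 4 := by positivity
    have t₀ := φ₀.tendsto_partialSq.eventually_lt_const hη2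
    have t₁ := φ₁.tendsto_partialSq.eventually_lt_const hη2
    have t₂ := (Metric.tendstoUniformly_iff.1 (tendstoUniformly_tail G.continuous)) _ hη2
    filter_upwards [t₀, t₁, t₂] with S h₀ h₁ h₂ p
    rw [dist_eq_norm]
    have hle : ‖V p - VS S p‖ ^ 2 ≤ η ^ 2 / 4 + η ^ 2 / 4 + η ^ 2 / 4 := by
      refine Hs.norm_sq_le_of_partialSq_le fun S' => ?_
      have hd : partialSq (r + 1) (V p - VS S p).coeff S' =
          partialSq (r + 1) (fun n => y p.1 n p.2) (S' \ S) := by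
        simp only [partialSq, Hs.coeff_sub, Pi.sub_apply, hVSc, hV]
        rw [Finset.sdiff_eq_filter, Finset.sum_filter]
        refine Finset.sum_congr rfl fun n _ => ?_
        by_cases hn : n ∈ S <;> simp [hn]
      rw [hd]
      refine (hest p.1 p.2 (S' \ S) (η ^ 2 / 4) fun q => ?_).trans ?_
      · have := h₂ q
        rw [dist_comm, Real.dist_0_eq_abs] at this
        exact ((G q).partialSq_sdiff_le S S').trans ((le_abs_self _).trans this.le)
      · linarith [φ₀.partialSq_sdiff_le S S', φ₁.partialSq_sdiff_le S S']
    refine lt_of_pow_lt_pow_left₀ 2 hη.le (hle.trans_lt ?_)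
    nlinarith [pow_pos hη 2]
  refine ⟨⟨V, hVcont⟩, fun ε => ⟨fun t n => w ε n t, fun n => ?_, ?_, fun h => ?_⟩⟩
  · have key : ∀ t ∈ Set.Icc 0 T, (V (ε, Set.projIcc 0 T hT t)).coeff n = y ε n t := by
      intro t ht
      rw [hV, Set.projIcc_of_mem hT ht]
    refine ⟨fun t ht => ((hy ε n).deriv t ht).congr key (key t ht), fun h t ht => ?_,
      fun h t ht => ?_⟩
    · simp only [ContinuousMap.coe_mk, key t ht]
      exact (hy ε n).eq_zero h t ht
    · simp only [ContinuousMap.coe_mk, key t ht]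
      exact (hy ε n).eq_pos h t ht
  · simp only [ContinuousMap.coe_mk]
    rw [hV, Set.projIcc_of_mem hT ⟨le_rfl, hT⟩]
    exact funext fun n => hy0 ε n
  · exact funext fun n => hw0 ε n h

/-! ### Solutions of the linear equation with data and force -/

/-- `v` solves the linear equation with data `φ₀, φ₁` and force `G`, for every `ε ∈ [0,1]`. -/
def Solves {r s s₀ s₁ T : ℝ} (hT : 0 ≤ T) (φ₀ : Hs s₀) (φ₁ : Hs s₁)
    (G : C(Set.Icc (0 : ℝ) 1 × Set.Icc (0 : ℝ) T, Hs r))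
    (v : C(Set.Icc (0 : ℝ) 1 × Set.Icc (0 : ℝ) T, Hs s)) : Prop :=
  ∀ ε : Set.Icc (0 : ℝ) 1, ∃ w : ℝ → Freq → ℂ,
    LinSol ε T (fun t => (v (ε, Set.projIcc 0 T hT t)).coeff) w
      (fun t => (G (ε, Set.projIcc 0 T hT t)).coeff) ∧
    (v (ε, Set.projIcc 0 T hT 0)).coeff = φ₀.coeff ∧ (0 < (ε : ℝ) → w 0 = φ₁.coeff)

lemma continuous_slice {E : Type*} [TopologicalSpace E] {T : ℝ} (hT : 0 ≤ T)
    (G : C(Set.Icc (0 : ℝ) 1 × Set.Icc (0 : ℝ) T, E)) (ε : Set.Icc (0 : ℝ) 1) :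
    Continuous fun t => G (ε, Set.projIcc 0 T hT t) := by
  have := continuous_projIcc (a := (0 : ℝ)) (b := T) (h := hT)
  fun_prop

namespace Solves

variable {r s₀ s₁ T : ℝ} {hT : 0 ≤ T} {φ₀ φ₀' : Hs s₀} {φ₁ φ₁' : Hs s₁}
  {G G' : C(Set.Icc (0 : ℝ) 1 × Set.Icc (0 : ℝ) T, Hs r)}
  {v v' : C(Set.Icc (0 : ℝ) 1 × Set.Icc (0 : ℝ) T, Hs (r + 1))}

lemma zero : Solves hT (0 : Hs s₀) (0 : Hs s₁)
    (0 : C(Set.Icc (0 : ℝ) 1 × Set.Icc (0 : ℝ) T, Hs r))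
    (0 : C(Set.Icc (0 : ℝ) 1 × Set.Icc (0 : ℝ) T, Hs (r + 1))) := by
  intro ε
  refine ⟨fun _ _ => 0, fun n => ⟨fun t _ => ?_, fun _ t _ => ?_, fun _ t _ => ⟨0, ?_, ?_⟩⟩, ?_,
    fun _ => ?_⟩
  · simpa using hasDerivWithinAt_const t (Set.Icc 0 T) (0 : ℂ)
  · simp
  · exact hasDerivWithinAt_const t (Set.Icc 0 T) (0 : ℂ)
  · simp
  · simp
  · funext n; simp

lemma norm_sub_sq_le (h : Solves hT φ₀ φ₁ G v) (h' : Solves hT φ₀' φ₁' G' v') (hs₀ : r + 1 ≤ s₀)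
    (hs₁ : r ≤ s₁) (ε : Set.Icc (0 : ℝ) 1) {t : ℝ} (ht : t ∈ Set.Icc 0 T) :
    ‖v (ε, Set.projIcc 0 T hT t) - v' (ε, Set.projIcc 0 T hT t)‖ ^ 2 ≤
      ‖φ₀ - φ₀'‖ ^ 2 + ‖φ₁ - φ₁'‖ ^ 2 + 1 / 2 * ∫ τ in (0 : ℝ)..t,
        ‖G (ε, Set.projIcc 0 T hT τ) - G' (ε, Set.projIcc 0 T hT τ)‖ ^ 2 := by
  obtain ⟨w, hl, h0, h1⟩ := h ε
  obtain ⟨w', hl', h0', h1'⟩ := h' ε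
  refine LinSol.norm_sq_le (w := fun t => w t - w' t)
    (V := fun t => v (ε, Set.projIcc 0 T hT t) - v' (ε, Set.projIcc 0 T hT t))
    (G := fun t => G (ε, Set.projIcc 0 T hT t) - G' (ε, Set.projIcc 0 T hT t))
    (hl.sub hl') ε.2 hs₀ hs₁ ?_ (fun hε => ?_)
    ((continuous_slice hT G ε).sub (continuous_slice hT G' ε)) (fun t => rfl) ht
  · rw [Hs.coeff_sub, Hs.coeff_sub, h0, h0']
  · rw [Hs.coeff_sub, h1 hε, h1' hε]

lemma norm_sub_sq_le_of_bound (h : Solves hT φ₀ φ₁ G v) (h' : Solves hT φ₀' φ₁' G' v')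
    (hs₀ : r + 1 ≤ s₀) (hs₁ : r ≤ s₁) {M : ℝ} (hM : ∀ p, ‖G p - G' p‖ ≤ M)
    (p : Set.Icc (0 : ℝ) 1 × Set.Icc (0 : ℝ) T) :
    ‖v p - v' p‖ ^ 2 ≤ ‖φ₀ - φ₀'‖ ^ 2 + ‖φ₁ - φ₁'‖ ^ 2 + 1 / 2 * (T * M ^ 2) := by
  obtain ⟨ε, t⟩ := p
  have := h.norm_sub_sq_le h' hs₀ hs₁ ε t.2
  rw [Set.projIcc_of_mem hT t.2] at this
  refine this.trans ?_
  gcongr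
  calc _ ≤ ∫ τ in (0 : ℝ)..t, M ^ 2 :=
        intervalIntegral.integral_mono_on t.2.1
          ((((continuous_slice hT G ε).sub (continuous_slice hT G' ε)).norm.pow
            2).intervalIntegrable _ _)
          (continuous_const.intervalIntegrable _ _) fun τ _ =>
            pow_le_pow_left₀ (norm_nonneg _) (hM _) 2
    _ = t * M ^ 2 := by simp
    _ ≤ T * M ^ 2 := by gcongr; exact t.2.2

end Solves

lemma exists_solves {r s₀ s₁ T : ℝ} (hT : 0 ≤ T) (hT1 : T ≤ 1) (hs₀ : r + 1 ≤ s₀) (hs₁ : r ≤ s₁)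
    (φ₀ : Hs s₀) (φ₁ : Hs s₁) (G : C(Set.Icc (0 : ℝ) 1 × Set.Icc (0 : ℝ) T, Hs r)) :
    ∃ v : C(Set.Icc (0 : ℝ) 1 × Set.Icc (0 : ℝ) T, Hs (r + 1)), Solves hT φ₀ φ₁ G v := by
  obtain ⟨I₀, h₀⟩ := Hs.exists_inclusion hs₀
  obtain ⟨I₁, h₁⟩ := Hs.exists_inclusion hs₁
  obtain ⟨v, hv⟩ := exists_linSol hT hT1 (I₀ φ₀) (I₁ φ₁) G
  rw [h₀, h₁] at hv
  exact ⟨v, hv⟩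

/-! ### The nonlinear force -/

section Force

variable {k : ℕ} {r s θ T : ℝ} {𝒩 : (Fin k → WInf (-θ)) × Hs s → Hs r}

/-- The force `-∑_ℓ binom(k,ℓ) Ξ_ℓ v^{k-ℓ}`. -/
noncomputable def force (h𝒩 : Continuous 𝒩)
    (Ξ : Fin k → C(Set.Icc (0 : ℝ) 1 × Set.Icc (0 : ℝ) 1, WInf (-θ)))
    (v : C(Set.Icc (0 : ℝ) 1 × Set.Icc (0 : ℝ) T, Hs s)) :
    C(Set.Icc (0 : ℝ) 1 × Set.Icc (0 : ℝ) T, Hs r) where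
  -- The projection changes no time as long as `T ≤ 1`.
  toFun p := -𝒩 (fun j => Ξ j (p.1, Set.projIcc 0 1 zero_le_one p.2), v p)
  continuous_toFun := by
    have := continuous_projIcc (a := (0 : ℝ)) (b := 1) (h := zero_le_one)
    fun_prop

lemma force_apply (h𝒩 : Continuous 𝒩)
    (Ξ : Fin k → C(Set.Icc (0 : ℝ) 1 × Set.Icc (0 : ℝ) 1, WInf (-θ)))
    (v : C(Set.Icc (0 : ℝ) 1 × Set.Icc (0 : ℝ) T, Hs s))
    (p : Set.Icc (0 : ℝ) 1 × Set.Icc (0 : ℝ) T) :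
    force h𝒩 Ξ v p = -𝒩 (fun j => Ξ j (p.1, Set.projIcc 0 1 zero_le_one p.2), v p) := rfl

/-- Moving the nonlinearity to the right makes the problem a fixed-point equation for the linear
solution map, to which the energy estimate applies. -/
lemma isSolution_iff_solves (h𝒩 : Continuous 𝒩)
    (h𝒩c : ∀ ξ f, (𝒩 (ξ, f)).coeff = nonlinearity (fun j => (ξ j).coeff) f.coeff) {s₀ s₁ : ℝ}
    (hT : 0 ≤ T) (φ₀ : Hs s₀) (φ₁ : Hs s₁)
    (Ξ : Fin k → C(Set.Icc (0 : ℝ) 1 × Set.Icc (0 : ℝ) 1, WInf (-θ)))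
    (v : C(Set.Icc (0 : ℝ) 1 × Set.Icc (0 : ℝ) T, Hs s)) :
    IsSolution hT φ₀ φ₁ Ξ v ↔ Solves hT φ₀ φ₁ (force h𝒩 Ξ v) v := by
  have hforce : ∀ (ε : Set.Icc (0 : ℝ) 1), ∀ t ∈ Set.Icc 0 T, ∀ n,
      (force h𝒩 Ξ v (ε, Set.projIcc 0 T hT t)).coeff n =
        -nonlinearity (fun j => (Ξ j (ε, Set.projIcc 0 1 zero_le_one t)).coeff)
          (v (ε, Set.projIcc 0 T hT t)).coeff n := by
    intro ε t ht n
    simp only [force_apply, Hs.coeff_neg, Pi.neg_apply, h𝒩c,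
      Set.projIcc_of_mem hT ht]
  refine forall_congr' fun ε => exists_congr fun w => ⟨?_, ?_⟩
  · rintro ⟨h0, hd, hz, hp⟩
    dsimp only at h0 hd hz hp
    refine ⟨fun n => ⟨fun t ht => hd t ht n, fun hε t ht => ?_, fun hε t ht => ?_⟩, h0,
      fun hε => (hp hε).1⟩
    · have := hz hε t ht n
      beta_reduce
      rw [hforce ε t ht]
      push_cast
      linear_combination this
    · obtain ⟨a, ha, e⟩ := (hp hε).2 t ht n
      refine ⟨a, ha, ?_⟩
      beta_reduce
      rw [hforce ε t ht]
      push_cast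
      linear_combination e
  · rintro ⟨hl, h0, h1⟩
    refine ⟨h0, fun t ht n => (hl n).deriv t ht, fun hε t ht n => ?_, fun hε => ⟨h1 hε,
      fun t ht n => ?_⟩⟩
    · have := (hl n).eq_zero hε t ht
      beta_reduce at this ⊢
      rw [hforce ε t ht] at this
      push_cast at this
      linear_combination this
    · obtain ⟨a, ha, e⟩ := (hl n).eq_pos hε t ht
      refine ⟨a, ha, ?_⟩
      beta_reduce at e ⊢
      rw [hforce ε t ht] at e
      push_cast at e
      linear_combination e

/-- The bound is chosen before `T`, so the lifespan may be fixed in terms of it. -/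
lemma exists_force_bound (h𝒩 : LipBdd 𝒩) (R : ℝ) :
    ∃ M : ℝ, 0 ≤ M ∧ ∀ {T : ℝ} (Ξ : Fin k → C(Set.Icc (0 : ℝ) 1 × Set.Icc (0 : ℝ) 1, WInf (-θ)))
      (v : C(Set.Icc (0 : ℝ) 1 × Set.Icc (0 : ℝ) T, Hs s)) p, (∀ j, ‖Ξ j‖ ≤ R) → ‖v p‖ ≤ R →
      ‖force h𝒩.continuous Ξ v p‖ ≤ M := by
  obtain ⟨M, hM0, hM⟩ := h𝒩.exists_norm_le R
  refine ⟨M, hM0, fun Ξ v p hΞ hv => ?_⟩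
  rw [force_apply, norm_neg]
  have hR : 0 ≤ R := (norm_nonneg _).trans hv
  refine hM _ (max_le ((pi_norm_le_iff_of_nonneg hR).2 fun j => ?_) hv)
  exact ((Ξ j).norm_coe_le_norm _).trans (hΞ j)

lemma exists_force_lipschitz (h𝒩 : LipBdd 𝒩) (R : ℝ) :
    ∃ C : ℝ, 0 ≤ C ∧ ∀ {T : ℝ}
      (Ξ Ξ' : Fin k → C(Set.Icc (0 : ℝ) 1 × Set.Icc (0 : ℝ) 1, WInf (-θ)))
      (v v' : C(Set.Icc (0 : ℝ) 1 × Set.Icc (0 : ℝ) T, Hs s)) p, (∀ j, ‖Ξ j‖ ≤ R) →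
      (∀ j, ‖Ξ' j‖ ≤ R) → ‖v p‖ ≤ R → ‖v' p‖ ≤ R →
      ‖force h𝒩.continuous Ξ v p - force h𝒩.continuous Ξ' v' p‖ ≤
        C * (∑ j, ‖Ξ j - Ξ' j‖ + ‖v p - v' p‖) := by
  obtain ⟨C, hC0, hC⟩ := h𝒩 R
  refine ⟨C, hC0, fun Ξ Ξ' v v' p hΞ hΞ' hv hv' => ?_⟩
  have hR : 0 ≤ R := (norm_nonneg _).trans hv
  have hb : ∀ {Ξ : Fin k → C(Set.Icc (0 : ℝ) 1 × Set.Icc (0 : ℝ) 1, WInf (-θ))} {f : Hs s},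
      (∀ j, ‖Ξ j‖ ≤ R) → ‖f‖ ≤ R →
      ‖((fun j => Ξ j (p.1, Set.projIcc 0 1 zero_le_one p.2), f) :
        (Fin k → WInf (-θ)) × Hs s)‖ ≤ R := fun {Ξ f} hΞ hf =>
    max_le ((pi_norm_le_iff_of_nonneg hR).2 fun j =>
      ((Ξ j).norm_coe_le_norm _).trans (hΞ j)) hf
  rw [force_apply, force_apply, neg_sub_neg, norm_sub_rev]
  refine (hC _ _ (hb hΞ hv) (hb hΞ' hv')).trans ?_
  have hS : 0 ≤ ∑ j, ‖Ξ j - Ξ' j‖ := Finset.sum_nonneg fun _ _ => norm_nonneg _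
  gcongr
  refine max_le ((pi_norm_le_iff_of_nonneg (by positivity)).2 fun j => ?_) ?_
  · have h1 := (Ξ j - Ξ' j).norm_coe_le_norm (p.1, Set.projIcc 0 1 zero_le_one p.2)
    have h2 := Finset.single_le_sum (f := fun j => ‖Ξ j - Ξ' j‖) (fun _ _ => norm_nonneg _)
      (Finset.mem_univ j)
    exact h1.trans (h2.trans (le_add_of_nonneg_right (norm_nonneg _)))
  · exact le_add_of_nonneg_left hS

end Force

/-! ### Uniqueness -/

/-- Grönwall's inequality is applied to the primitive of `g`, which vanishes at `0` and has
derivative `g`. -/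
lemma eq_zero_of_le_integral {T C : ℝ} {g : ℝ → ℝ} (hg : Continuous g) (hg0 : ∀ t, 0 ≤ g t)
    (h : ∀ t ∈ Set.Icc 0 T, g t ≤ C * ∫ τ in (0 : ℝ)..t, g τ) {t : ℝ} (ht : t ∈ Set.Icc 0 T) :
    g t = 0 := by
  have hd : ∀ t, HasDerivAt (fun t => ∫ τ in (0 : ℝ)..t, g τ) (g t) t := fun t =>
    intervalIntegral.integral_hasDerivAt_right (hg.intervalIntegrable _ _)
      (hg.stronglyMeasurableAtFilter _ _) hg.continuousAt
  have hI : ∀ t ∈ Set.Icc 0 T, 0 ≤ ∫ τ in (0 : ℝ)..t, g τ := fun t ht =>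
    intervalIntegral.integral_nonneg ht.1 fun τ _ => hg0 τ
  have hG := norm_le_gronwallBound_of_norm_deriv_right_le (δ := 0) (K := C) (ε := 0)
    (fun t _ => (hd t).continuousAt.continuousWithinAt) (fun t _ => (hd t).hasDerivWithinAt)
    (by simp) (fun t ht => by
      rw [Real.norm_of_nonneg (hg0 t), Real.norm_of_nonneg (hI t ⟨ht.1, ht.2.le⟩), add_zero]
      exact h t ⟨ht.1, ht.2.le⟩) t ht
  rw [gronwallBound_ε0_δ0, Real.norm_of_nonneg (hI t ht)] at hG
  have hz : ∫ τ in (0 : ℝ)..t, g τ = 0 := le_antisymm hG (hI t ht)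
  have := h t ht
  rw [hz, mul_zero] at this
  exact le_antisymm this (hg0 t)

lemma solves_force_unique {k : ℕ} {r θ s₀ s₁ T : ℝ}
    {𝒩 : (Fin k → WInf (-θ)) × Hs (r + 1) → Hs r} (h𝒩 : LipBdd 𝒩) (hT : 0 ≤ T)
    (hs₀ : r + 1 ≤ s₀) (hs₁ : r ≤ s₁) {φ₀ : Hs s₀} {φ₁ : Hs s₁}
    {Ξ : Fin k → C(Set.Icc (0 : ℝ) 1 × Set.Icc (0 : ℝ) 1, WInf (-θ))}
    {v v' : C(Set.Icc (0 : ℝ) 1 × Set.Icc (0 : ℝ) T, Hs (r + 1))}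
    (h : Solves hT φ₀ φ₁ (force h𝒩.continuous Ξ v) v)
    (h' : Solves hT φ₀ φ₁ (force h𝒩.continuous Ξ v') v') : v = v' := by
  -- The radius depends on the two solutions, so no a priori ball is assumed and uniqueness holds in
  -- the whole class.
  set R := ∑ j, ‖Ξ j‖ + ‖v‖ + ‖v'‖ with hR
  have hΞ0 : 0 ≤ ∑ j, ‖Ξ j‖ := Finset.sum_nonneg fun _ _ => norm_nonneg _
  have hΞ : ∀ j, ‖Ξ j‖ ≤ R := fun j => by
    have := Finset.single_le_sum (f := fun j => ‖Ξ j‖) (fun _ _ => norm_nonneg _)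
      (Finset.mem_univ j)
    linarith [norm_nonneg v, norm_nonneg v']
  obtain ⟨C, hC0, hC⟩ := exists_force_lipschitz h𝒩 R
  ext1 ⟨ε, t⟩
  have hle : ∀ p, ‖force h𝒩.continuous Ξ v p - force h𝒩.continuous Ξ v' p‖ ^ 2 ≤
      C ^ 2 * ‖v p - v' p‖ ^ 2 := fun p => by
    rw [← mul_pow]
    refine pow_le_pow_left₀ (norm_nonneg _) ?_ 2
    have := hC Ξ Ξ v v' p hΞ hΞ (by linarith [v.norm_coe_le_norm p, norm_nonneg v'])
      (by linarith [v'.norm_coe_le_norm p, norm_nonneg v])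
    simpa using this
  have hgc : Continuous fun t => ‖v (ε, Set.projIcc 0 T hT t) - v' (ε, Set.projIcc 0 T hT t)‖ ^ 2 :=
    ((continuous_slice hT v ε).sub (continuous_slice hT v' ε)).norm.pow 2
  have hz := eq_zero_of_le_integral (C := 1 / 2 * C ^ 2) hgc (fun _ => sq_nonneg _)
    (fun t ht => ?_) t.2
  · rw [Set.projIcc_of_mem hT t.2] at hz
    exact sub_eq_zero.1 (norm_eq_zero.1 (pow_eq_zero_iff two_ne_zero |>.1 hz))
  · refine (h.norm_sub_sq_le h' hs₀ hs₁ ε ht).trans ?_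
    rw [sub_self, sub_self, norm_zero, norm_zero, mul_assoc]
    have hmono := intervalIntegral.integral_mono_on (μ := volume) ht.1
      ((((continuous_slice hT (force h𝒩.continuous Ξ v) ε).sub
        (continuous_slice hT (force h𝒩.continuous Ξ v') ε)).norm.pow 2).intervalIntegrable _ _)
      ((continuous_const.mul hgc).intervalIntegrable _ _) fun τ _ => hle _
    simp only [Pi.pow_apply, Pi.sub_apply, Pi.mul_apply,
      intervalIntegral.integral_const_mul] at hmono
    linarith

/-! ### Complex conjugation -/

lemma Hs.exists_reflect (s : ℝ) : ∃ ρ : Hs s → Hs s, Continuous ρ ∧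
    ∀ f n, (ρ f).coeff n = starRingEnd ℂ (f.coeff (-n)) := by
  have hp : ∀ (a : Freq → ℂ) (S : Finset Freq),
      partialSq s (fun n => starRingEnd ℂ (a (-n))) S =
        partialSq s a (S.map (Equiv.neg Freq).toEmbedding) := by
    intro a S
    rw [partialSq, partialSq, Finset.sum_map]
    refine Finset.sum_congr rfl fun n _ => ?_
    simp [bracket_neg]
  choose ρ hρ using fun f : Hs s => Hs.exists_of_partialSq_le
    (a := fun n => starRingEnd ℂ (f.coeff (-n))) (C := ‖f‖ ^ 2) fun S => by
      rw [hp]; exact f.partialSq_le _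
  refine ⟨ρ, (LipschitzWith.of_dist_le_mul (K := 1) fun f g => ?_).continuous,
    fun f n => by rw [hρ]⟩
  rw [NNReal.coe_one, one_mul, dist_eq_norm, dist_eq_norm]
  refine Hs.norm_le_of_partialSq_le (norm_nonneg _) fun S => ?_
  have e : (ρ f - ρ g).coeff = fun n => starRingEnd ℂ ((f - g).coeff (-n)) := by
    funext n
    simp [hρ]
  rw [e, hp]
  exact Hs.partialSq_le _ _

lemma product_reflect (a b : Freq → ℂ) (n : Freq) :
    product (fun m => starRingEnd ℂ (a (-m))) (fun m => starRingEnd ℂ (b (-m))) n =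
      starRingEnd ℂ (product a b (-n)) := by
  rw [product, product, Complex.conj_tsum, ← (Equiv.neg Freq).tsum_eq]
  refine tsum_congr fun m => ?_
  rw [Equiv.neg_apply, neg_neg, map_mul]
  congr 3
  abel_nf

lemma power_reflect (a : Freq → ℂ) (j : ℕ) :
    power (fun m => starRingEnd ℂ (a (-m))) j = fun n => starRingEnd ℂ (power a j (-n)) := by
  induction j with
  | zero =>
    funext n
    by_cases hn : n = 0
    · simp [power, hn]
    · simp [power, hn]
  | succ j ih =>
    funext n
    rw [power, ih, product_reflect]
    rfl

lemma nonlinearity_reflect {k : ℕ} {ξ : Fin k → Freq → ℂ} (hξ : ∀ j, IsRealValued (ξ j))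
    (a : Freq → ℂ) (n : Freq) :
    nonlinearity ξ (fun m => starRingEnd ℂ (a (-m))) n = starRingEnd ℂ (nonlinearity ξ a (-n)) := by
  have e : ∀ j, ξ j = fun m => starRingEnd ℂ (ξ j (-m)) := fun j => by
    funext m
    rw [hξ j m, Complex.conj_conj]
  simp only [nonlinearity, map_add, map_sum, map_mul, map_natCast, power_reflect]
  congr 1
  refine Finset.sum_congr rfl fun j _ => ?_
  rw [← product_reflect, ← e]

/-- The coefficients of the equation are real and conjugation commutes with products, so conjugating
every mode and reflecting the frequency preserves the equation when data and sources are real. -/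
lemma IsSolution.reflect {k : ℕ} {s s₀ s₁ θ T : ℝ} {hT : 0 ≤ T} {φ₀ : Hs s₀} {φ₁ : Hs s₁}
    {Ξ : Fin k → C(Set.Icc (0 : ℝ) 1 × Set.Icc (0 : ℝ) 1, WInf (-θ))}
    {v v' : C(Set.Icc (0 : ℝ) 1 × Set.Icc (0 : ℝ) T, Hs s)} (h : IsSolution hT φ₀ φ₁ Ξ v)
    (h₀ : IsRealValued φ₀.coeff) (h₁ : IsRealValued φ₁.coeff)
    (hΞ : ∀ j p, IsRealValued (Ξ j p).coeff)
    (hv' : ∀ p, (v' p).coeff = fun n => starRingEnd ℂ ((v p).coeff (-n))) :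
    IsSolution hT φ₀ φ₁ Ξ v' := by
  intro ε
  obtain ⟨w, hu, hd, hz, hp⟩ := h ε
  dsimp only at hu hd hz hp
  refine ⟨fun t n => starRingEnd ℂ (w t (-n)), ?_⟩
  simp only [hv', nonlinearity_reflect fun j => hΞ j _]
  refine ⟨funext fun n => ?_, fun t ht n => (hd t ht (-n)).star, fun hε t ht n => ?_,
    fun hε => ⟨funext fun n => ?_, fun t ht n => ?_⟩⟩
  · rw [hu, h₀ n, Complex.conj_conj]
  · have := congrArg (starRingEnd ℂ) (hz hε t ht (-n))
    simpa [bracket_neg] using this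
  · rw [(hp hε).1, h₁ n, Complex.conj_conj]
  · obtain ⟨a, ha, e⟩ := (hp hε).2 t ht (-n)
    refine ⟨starRingEnd ℂ a, ha.star, ?_⟩
    have := congrArg (starRingEnd ℂ) e
    simpa [bracket_neg] using this

/-! ### Well-posedness -/

lemma norm_le_of_sum_le {k : ℕ} {E : Type*} [SeminormedAddCommGroup E] {Ξ : Fin k → E} {B : ℝ}
    (h : ∑ j, ‖Ξ j‖ ≤ B) (j : Fin k) : ‖Ξ j‖ ≤ B :=
  (Finset.single_le_sum (f := fun j => ‖Ξ j‖) (fun _ _ => norm_nonneg _)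
    (Finset.mem_univ j)).trans h

/-- Well-posedness for a nonlinearity that is Lipschitz on bounded sets from `H^{r+1}` to `H^r`. -/
lemma wellposed_of_lipBdd {k : ℕ} {r s s₀ s₁ θ : ℝ} (hs : s = r + 1) (hs₀ : s ≤ s₀) (hs₁ : r ≤ s₁)
    {𝒩 : (Fin k → WInf (-θ)) × Hs s → Hs r} (h𝒩 : LipBdd 𝒩)
    (h𝒩c : ∀ ξ f, (𝒩 (ξ, f)).coeff = nonlinearity (fun j => (ξ j).coeff) f.coeff) (A B : ℝ) :
    ∃ (T : ℝ) (hT : 0 < T) (L : ℝ), T ≤ 1 ∧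
      (∀ (φ₀ : Hs s₀) (φ₁ : Hs s₁)
        (Ξ : Fin k → C(Set.Icc (0 : ℝ) 1 × Set.Icc (0 : ℝ) 1, WInf (-θ))),
        ‖φ₀‖ + ‖φ₁‖ ≤ A → ∑ j, ‖Ξ j‖ ≤ B →
        ∃! v : C(Set.Icc (0 : ℝ) 1 × Set.Icc (0 : ℝ) T, Hs s), IsSolution hT.le φ₀ φ₁ Ξ v) ∧
      (∀ (φ₀ φ₀' : Hs s₀) (φ₁ φ₁' : Hs s₁)
        (Ξ Ξ' : Fin k → C(Set.Icc (0 : ℝ) 1 × Set.Icc (0 : ℝ) 1, WInf (-θ)))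
        (v v' : C(Set.Icc (0 : ℝ) 1 × Set.Icc (0 : ℝ) T, Hs s)),
        ‖φ₀‖ + ‖φ₁‖ ≤ A → ∑ j, ‖Ξ j‖ ≤ B → ‖φ₀'‖ + ‖φ₁'‖ ≤ A → ∑ j, ‖Ξ' j‖ ≤ B →
        IsSolution hT.le φ₀ φ₁ Ξ v → IsSolution hT.le φ₀' φ₁' Ξ' v' →
        ‖v - v'‖ ≤ L * (‖φ₀ - φ₀'‖ + ‖φ₁ - φ₁'‖ + ∑ j, ‖Ξ j - Ξ' j‖)) := by
  subst hs
  set R := |A| + |B| + 1 with hR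
  have hA0 := abs_nonneg A
  have hB0 := abs_nonneg B
  have hR0 : 0 ≤ R := by positivity
  obtain ⟨M, hM0, hM⟩ := exists_force_bound h𝒩 R
  obtain ⟨C, hC0, hC⟩ := exists_force_lipschitz h𝒩 R
  -- With `T = 1/D`, `T M² ≤ 1` keeps the ball of radius `R` invariant, as `|A|² + 1/2 ≤ R²`, and `T
  -- C² ≤ 1/4` bounds the squared contraction factor by `1/8`.
  set D := 1 + M ^ 2 + 4 * C ^ 2 with hD
  have hD0 : 0 < D := by positivity
  set T := 1 / D with hTdef
  have hT : 0 < T := by positivity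
  have hT1 : T ≤ 1 := by
    rw [hTdef, div_le_one hD0]
    nlinarith [sq_nonneg M, sq_nonneg C]
  have hTM : T * M ^ 2 ≤ 1 := by
    rw [hTdef, one_div_mul_eq_div, div_le_one hD0]
    nlinarith [sq_nonneg C]
  have hTC : T * C ^ 2 ≤ 1 / 4 := by
    rw [hTdef, one_div_mul_eq_div, div_le_iff₀ hD0]
    nlinarith [sq_nonneg M]
  have hΞR : ∀ {Ξ : Fin k → C(Set.Icc (0 : ℝ) 1 × Set.Icc (0 : ℝ) 1, WInf (-θ))},
      ∑ j, ‖Ξ j‖ ≤ B → ∀ j, ‖Ξ j‖ ≤ R := fun h j =>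
    (norm_le_of_sum_le h j).trans (by linarith [le_abs_self B])
  have hdata : ∀ {φ₀ : Hs s₀} {φ₁ : Hs s₁}, ‖φ₀‖ + ‖φ₁‖ ≤ A → ‖φ₀‖ ^ 2 + ‖φ₁‖ ^ 2 ≤ |A| ^ 2 := by
    intro φ₀ φ₁ h
    have h1 := h.trans (le_abs_self A)
    nlinarith [norm_nonneg φ₀, norm_nonneg φ₁]
  have hball : ∀ {φ₀ : Hs s₀} {φ₁ : Hs s₁}
      {Ξ : Fin k → C(Set.Icc (0 : ℝ) 1 × Set.Icc (0 : ℝ) 1, WInf (-θ))}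
      {u v : C(Set.Icc (0 : ℝ) 1 × Set.Icc (0 : ℝ) T, Hs (r + 1))},
      ‖φ₀‖ + ‖φ₁‖ ≤ A → ∑ j, ‖Ξ j‖ ≤ B → ‖u‖ ≤ R →
      Solves hT.le φ₀ φ₁ (force h𝒩.continuous Ξ u) v → ‖v‖ ≤ R := by
    intro φ₀ φ₁ Ξ u v hφ hΞ hu hv
    refine (ContinuousMap.norm_le _ hR0).2 fun p => ?_
    have h := hv.norm_sub_sq_le_of_bound Solves.zero hs₀ hs₁ (M := M) (fun p => by
      simpa using hM Ξ u p (hΞR hΞ) ((u.norm_coe_le_norm p).trans hu)) p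
    simp only [ContinuousMap.zero_apply, sub_zero] at h
    refine le_of_sq_le_sq ?_ hR0
    have := hdata hφ
    nlinarith
  have hexists : ∀ {φ₀ : Hs s₀} {φ₁ : Hs s₁}
      {Ξ : Fin k → C(Set.Icc (0 : ℝ) 1 × Set.Icc (0 : ℝ) 1, WInf (-θ))},
      ‖φ₀‖ + ‖φ₁‖ ≤ A → ∑ j, ‖Ξ j‖ ≤ B →
      ∃ v : C(Set.Icc (0 : ℝ) 1 × Set.Icc (0 : ℝ) T, Hs (r + 1)), ‖v‖ ≤ R ∧
        Solves hT.le φ₀ φ₁ (force h𝒩.continuous Ξ v) v := by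
    intro φ₀ φ₁ Ξ hφ hΞ
    -- Any choice of linear solutions will do, since the difference estimate holds for all of them.
    choose Γ hΓ using fun u : C(Set.Icc (0 : ℝ) 1 × Set.Icc (0 : ℝ) T, Hs (r + 1)) =>
      exists_solves hT.le hT1 hs₀ hs₁ φ₀ φ₁ (force h𝒩.continuous Ξ u)
    have hmaps : Set.MapsTo Γ (Metric.closedBall 0 R) (Metric.closedBall 0 R) := fun u hu => by
      rw [mem_closedBall_zero_iff] at hu ⊢
      exact hball hφ hΞ hu (hΓ u)
    have hcontr : ContractingWith (1 / 2) (hmaps.restrict Γ _ _) := by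
      refine ⟨by norm_num, LipschitzWith.of_dist_le_mul ?_⟩
      rintro ⟨u, hu⟩ ⟨u', hu'⟩
      rw [mem_closedBall_zero_iff] at hu hu'
      change dist (Γ u) (Γ u') ≤ ((1 / 2 : NNReal) : ℝ) * dist u u'
      rw [dist_eq_norm, dist_eq_norm]
      have h2 : ((1 / 2 : NNReal) : ℝ) = 1 / 2 := by simp
      rw [h2]
      refine (ContinuousMap.norm_le _ (by positivity)).2 fun p => ?_
      set d := ‖u - u'‖ with hd
      have h := (hΓ u).norm_sub_sq_le_of_bound (hΓ u') hs₀ hs₁ (M := C * d) (fun p => by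
        refine (hC Ξ Ξ u u' p (hΞR hΞ) (hΞR hΞ) ((u.norm_coe_le_norm p).trans hu)
          ((u'.norm_coe_le_norm p).trans hu')).trans ?_
        simp only [sub_self, norm_zero, Finset.sum_const_zero, zero_add]
        gcongr
        exact (u - u').norm_coe_le_norm p) p
      rw [sub_self, sub_self, norm_zero, norm_zero] at h
      refine le_of_sq_le_sq ?_ (by positivity)
      rw [ContinuousMap.sub_apply]
      nlinarith [sq_nonneg d, mul_le_mul_of_nonneg_right hTC (sq_nonneg d)]
    obtain ⟨v, hv, hfix, -⟩ := hcontr.exists_fixedPoint' Metric.isClosed_closedBall.isComplete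
      hmaps (Metric.mem_closedBall_self hR0) (edist_ne_top _ _)
    refine ⟨v, mem_closedBall_zero_iff.1 hv, ?_⟩
    have := hΓ v
    rw [hfix.eq] at this
    exact this
  have hiff := fun φ₀ φ₁ Ξ v =>
    isSolution_iff_solves (s₀ := s₀) (s₁ := s₁) h𝒩.continuous h𝒩c hT.le φ₀ φ₁ Ξ v
  -- The difference `d` of two solutions will satisfy `d ≤ a + b + (S + d)/2`, hence `d ≤ 2(a + b) +
  -- S`, which this constant dominates.
  refine ⟨T, hT, 2 * (1 + C), hT1, ?_, ?_⟩
  · intro φ₀ φ₁ Ξ hφ hΞ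
    obtain ⟨v, -, hv⟩ := hexists hφ hΞ
    exact ⟨v, (hiff _ _ _ _).2 hv, fun v' hv' =>
      solves_force_unique h𝒩 hT.le hs₀ hs₁ ((hiff _ _ _ _).1 hv') hv⟩
  · intro φ₀ φ₀' φ₁ φ₁' Ξ Ξ' v v' hφ hΞ hφ' hΞ' hv hv'
    rw [hiff] at hv hv'
    -- An arbitrary solution has no a priori bound; uniqueness identifies it with the fixed point in
    -- the ball.
    have hvR : ‖v‖ ≤ R := by
      obtain ⟨u, hu, hus⟩ := hexists hφ hΞ
      rwa [solves_force_unique h𝒩 hT.le hs₀ hs₁ hv hus]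
    have hvR' : ‖v'‖ ≤ R := by
      obtain ⟨u, hu, hus⟩ := hexists hφ' hΞ'
      rwa [solves_force_unique h𝒩 hT.le hs₀ hs₁ hv' hus]
    have hS : 0 ≤ ∑ j, ‖Ξ j - Ξ' j‖ := Finset.sum_nonneg fun _ _ => norm_nonneg _
    set S := ∑ j, ‖Ξ j - Ξ' j‖
    set d := ‖v - v'‖ with hd
    have hd0 : 0 ≤ d := norm_nonneg _
    set a := ‖φ₀ - φ₀'‖
    set b := ‖φ₁ - φ₁'‖
    have ha : 0 ≤ a := norm_nonneg _
    have hb : 0 ≤ b := norm_nonneg _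
    have hsq : ∀ p, ‖v p - v' p‖ ^ 2 ≤ a ^ 2 + b ^ 2 + 1 / 2 * (T * (C * (S + d)) ^ 2) :=
      hv.norm_sub_sq_le_of_bound hv' hs₀ hs₁ fun p => by
        refine (hC Ξ Ξ' v v' p (hΞR hΞ) (hΞR hΞ') ((v.norm_coe_le_norm p).trans hvR)
          ((v'.norm_coe_le_norm p).trans hvR')).trans ?_
        gcongr
        exact (v - v').norm_coe_le_norm p
    have hle : d ≤ a + b + 1 / 2 * (S + d) := by
      refine (ContinuousMap.norm_le _ (by positivity)).2 fun p => ?_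
      refine le_of_sq_le_sq ((hsq p).trans ?_) (by positivity)
      have h1 := mul_le_mul_of_nonneg_right hTC (sq_nonneg (S + d))
      nlinarith [mul_nonneg ha hb, mul_nonneg ha (add_nonneg hS hd0),
        mul_nonneg hb (add_nonneg hS hd0), sq_nonneg (S + d)]
    nlinarith [mul_nonneg hC0 ha, mul_nonneg hC0 hb, mul_nonneg hC0 hS]

lemma IsSolution.isRealValued {k : ℕ} {s s₀ s₁ θ T : ℝ} {hT : 0 ≤ T} {φ₀ : Hs s₀} {φ₁ : Hs s₁}
    {Ξ : Fin k → C(Set.Icc (0 : ℝ) 1 × Set.Icc (0 : ℝ) 1, WInf (-θ))}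
    {v : C(Set.Icc (0 : ℝ) 1 × Set.Icc (0 : ℝ) T, Hs s)} (h : IsSolution hT φ₀ φ₁ Ξ v)
    (hunique : ∃! v : C(Set.Icc (0 : ℝ) 1 × Set.Icc (0 : ℝ) T, Hs s), IsSolution hT φ₀ φ₁ Ξ v)
    (h₀ : IsRealValued φ₀.coeff) (h₁ : IsRealValued φ₁.coeff)
    (hΞ : ∀ j p, IsRealValued (Ξ j p).coeff) (p : Set.Icc (0 : ℝ) 1 × Set.Icc (0 : ℝ) T) :
    IsRealValued (v p).coeff := by
  obtain ⟨ρ, hρ, hρc⟩ := Hs.exists_reflect s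
  have hv := h.reflect (v' := ⟨fun p => ρ (v p), hρ.comp v.continuous⟩) h₀ h₁ hΞ
    fun p => funext fun n => hρc _ n
  have e := hunique.unique h hv
  intro n
  have e1 : v p = ρ (v p) := congrArg (fun u : C(_, Hs s) => u p) e
  conv_lhs => rw [e1]
  rw [hρc, neg_neg]

end SNLW

theorem proposition4p3 :
    ∃ c : ℝ, 0 < c ∧ ∀ (k : ℕ) (δ θ : ℝ), 2 ≤ k → 0 < θ → θ ≤ c * δ →
      δ ≤ 1 / (2 * ((k : ℝ) - 1)) + θ / 2 →
      -- all products in the equation are well defined on the solution class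
      (∀ f : SNLW.Hs (1 - δ),
        (∀ j < k, SNLW.ProductDefined (SNLW.power f.coeff j) f.coeff) ∧
        (∀ ξ : SNLW.WInf (-θ), ∀ j < k, SNLW.ProductDefined ξ.coeff (SNLW.power f.coeff j))) ∧
      -- well-posedness, with a time and a Lipschitz constant that depend only on the data norms
      ∀ A B : ℝ, ∃ (T : ℝ) (hT : 0 < T) (L : ℝ), T ≤ 1 ∧
        -- existence, and uniqueness in the whole class `C([0,1] × [0,T]; H^{1-δ})`
        (∀ (φ₀ : SNLW.Hs (1 - δ + θ)) (φ₁ : SNLW.Hs (-δ + θ))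
          (Ξ : Fin k → C(Set.Icc (0 : ℝ) 1 × Set.Icc (0 : ℝ) 1, SNLW.WInf (-θ))),
          ‖φ₀‖ + ‖φ₁‖ ≤ A → ∑ j, ‖Ξ j‖ ≤ B →
          ∃! v : C(Set.Icc (0 : ℝ) 1 × Set.Icc (0 : ℝ) T, SNLW.Hs (1 - δ)),
            SNLW.IsSolution hT.le φ₀ φ₁ Ξ v) ∧
        -- the solution map is Lipschitz on bounded sets of data
        (∀ (φ₀ φ₀' : SNLW.Hs (1 - δ + θ)) (φ₁ φ₁' : SNLW.Hs (-δ + θ))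
          (Ξ Ξ' : Fin k → C(Set.Icc (0 : ℝ) 1 × Set.Icc (0 : ℝ) 1, SNLW.WInf (-θ)))
          (v v' : C(Set.Icc (0 : ℝ) 1 × Set.Icc (0 : ℝ) T, SNLW.Hs (1 - δ))),
          ‖φ₀‖ + ‖φ₁‖ ≤ A → ∑ j, ‖Ξ j‖ ≤ B → ‖φ₀'‖ + ‖φ₁'‖ ≤ A → ∑ j, ‖Ξ' j‖ ≤ B →
          SNLW.IsSolution hT.le φ₀ φ₁ Ξ v → SNLW.IsSolution hT.le φ₀' φ₁' Ξ' v' →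
          ‖v - v'‖ ≤ L * (‖φ₀ - φ₀'‖ + ‖φ₁ - φ₁'‖ + ∑ j, ‖Ξ j - Ξ' j‖)) ∧
        -- real-valued data give real-valued solutions
        (∀ (φ₀ : SNLW.Hs (1 - δ + θ)) (φ₁ : SNLW.Hs (-δ + θ))
          (Ξ : Fin k → C(Set.Icc (0 : ℝ) 1 × Set.Icc (0 : ℝ) 1, SNLW.WInf (-θ)))
          (v : C(Set.Icc (0 : ℝ) 1 × Set.Icc (0 : ℝ) T, SNLW.Hs (1 - δ))),
          ‖φ₀‖ + ‖φ₁‖ ≤ A → ∑ j, ‖Ξ j‖ ≤ B →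
          SNLW.IsRealValued φ₀.coeff → SNLW.IsRealValued φ₁.coeff →
          (∀ j p, SNLW.IsRealValued (Ξ j p).coeff) →
          SNLW.IsSolution hT.le φ₀ φ₁ Ξ v → ∀ p, SNLW.IsRealValued (v p).coeff) := by
  -- The value `1/10` gives `(k-1)δ ≤ 10/19`, small enough to afford a loss of `3δ/2` per factor and
  -- still leave regularity `θ`.
  refine ⟨1 / 10, by norm_num, fun k δ θ hk hθ hθδ hδ => ?_⟩
  have hadm : SNLW.Admissible k δ θ := ⟨hk, hθ, hθδ, hδ⟩
  refine ⟨fun f => ⟨fun j hj => hadm.productDefined_power f hj,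
    fun ξ j hj => hadm.productDefined_wInf f ξ hj⟩, fun A B => ?_⟩
  obtain ⟨𝒩, h𝒩, h𝒩c⟩ := hadm.exists_nonlinearity
  obtain ⟨T, hT, L, hT1, hex, hlip⟩ := SNLW.wellposed_of_lipBdd (r := -δ) (s := 1 - δ)
    (s₀ := 1 - δ + θ) (s₁ := -δ + θ) (by ring) (by linarith) (by linarith) h𝒩 h𝒩c A B
  exact ⟨T, hT, L, hT1, hex, hlip, fun φ₀ φ₁ Ξ v hφ hΞ h₀ h₁ hreal hv =>
    hv.isRealValued (hex φ₀ φ₁ Ξ hφ hΞ) h₀ h₁ hreal⟩
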